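/- Let $\mathcal H_A$ (Alice) and $\mathcal H_B$ (Bob) be complex Hilbert spaces, of finite or infinite dimension. Let $\sigma$ be a state (positive trace class operator of trace one) on $\mathcal H_B$ of full rank (i.e. with dense range), and let $\sigma=\sum_n s_n|n\rangle\langle n|$ be its eigendecomposition in an orthonormal basis $\{|n\rangle\}$ of $\mathcal H_B$. Let $|\Omega_\sigma\rangle:=\sum_n\sqrt{s_n}\,|n\rangle\otimes|n\rangle\in\mathcal H_B\otimes\mathcal H_B$ be the corresponding canonical purification of $\sigma$. A quantum channel from Bob to Alice is a completely positive trace preserving linear map $\mathsf T$ from the trace class operators on $\mathcal H_B$ to the trace class operators on $\mathcal H_A$. Then the map $$\mathsf T\mapsto \rho=(\mathsf T\otimes\mathrm{Id})\big(|\Omega_\sigma\rangle\langle\Omega_\sigma|\big)$$ is a one-to-one correspondence between the quantum channels $\mathsf T$ from Bob to Alice and the bipartite states $\rho$ on $\mathcal H_A\otimes\mathcal H_B$ with marginal $\mathrm{tr}_A[\rho]=\sigma$. -/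

import Mathlib

open scoped InnerProductSpace TensorProduct ComplexOrder

noncomputable section

namespace QChannel

variable {H : Type*} [NormedAddCommGroup H] [InnerProductSpace ℂ H] [CompleteSpace H]

/-- Index set of a fixed orthonormal (Hilbert) basis of `H`. -/
def stdIndex (H : Type*) [NormedAddCommGroup H] [InnerProductSpace ℂ H] [CompleteSpace H] :
    Set H :=
  (exists_hilbertBasis ℂ H).choose

/-- A fixed orthonormal (Hilbert) basis of `H`. The traces below do not depend on it. -/
def stdBasis (H : Type*) [NormedAddCommGroup H] [InnerProductSpace ℂ H] [CompleteSpace H] :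
    HilbertBasis (stdIndex H) ℂ H :=
  (exists_hilbertBasis ℂ H).choose_spec.choose

/-- The trace `∑ᵢ ⟨bᵢ, P bᵢ⟩ ∈ [0, ∞]` of a positive operator `P`. -/
def posTrace (P : H →L[ℂ] H) : ENNReal :=
  ∑' i, ENNReal.ofReal (⟪stdBasis H i, P (stdBasis H i)⟫_ℂ).re

/-- The trace class operators on `H`: the linear span of the positive operators with finite
trace. -/
def TraceClass (H : Type*) [NormedAddCommGroup H] [InnerProductSpace ℂ H] [CompleteSpace H] :
    Submodule ℂ (H →L[ℂ] H) :=
  Submodule.span ℂ {P | P.IsPositive ∧ posTrace P ≠ ⊤}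

set_option linter.unusedSectionVars false
set_option linter.unusedSimpArgs false

theorem ofReal_norm_sq_eq_tsum {ι : Type*} (c : HilbertBasis ι ℂ H) (x : H) :
    ENNReal.ofReal (‖x‖ ^ 2) = ∑' j, ENNReal.ofReal (‖⟪c j, x⟫_ℂ‖ ^ 2) := by
  have h := c.hasSum_inner_mul_inner x x
  have h2 : HasSum (fun j => ‖⟪c j, x⟫_ℂ‖ ^ 2) (‖x‖ ^ 2) := by
    have h3 := Complex.hasSum_re h
    rw [inner_self_eq_norm_sq_to_K] at h3
    convert h3 using 1
    · funext j
      rw [← inner_conj_symm x (c j), ← Complex.normSq_eq_conj_mul_self, Complex.normSq_eq_norm_sq,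
        Complex.ofReal_re]
    · norm_cast
  rw [← h2.tsum_eq, ENNReal.ofReal_tsum_of_nonneg (fun _ => by positivity) h2.summable]

theorem exists_sqrt {P : H →L[ℂ] H} (hP : P.IsPositive) :
    ∃ S : H →L[ℂ] H, IsSelfAdjoint S ∧ P = S * S := by
  have h0 : 0 ≤ P := (ContinuousLinearMap.nonneg_iff_isPositive P).2 hP
  exact ⟨CFC.sqrt P, (CFC.sqrt_nonneg P).isSelfAdjoint, (CFC.sqrt_mul_sqrt_self P h0).symm⟩

theorem posTrace_aux {ι κ : Type*} (b : HilbertBasis ι ℂ H) (c : HilbertBasis κ ℂ H)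
    {P : H →L[ℂ] H} (hP : P.IsPositive) :
    ∑' i, ENNReal.ofReal (⟪b i, P (b i)⟫_ℂ).re = ∑' i, ENNReal.ofReal (⟪c i, P (c i)⟫_ℂ).re := by
  obtain ⟨S, hS, rfl⟩ := exists_sqrt hP
  have key : ∀ x y : H, ⟪x, S y⟫_ℂ = ⟪S x, y⟫_ℂ := fun x y => (hS.isSymmetric x y).symm
  have e : ∀ x : H, (⟪x, (S * S) x⟫_ℂ).re = ‖S x‖ ^ 2 := fun x => by
    rw [mul_apply_eq_comp, key, inner_self_eq_norm_sq_to_K]; norm_cast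
  simp_rw [e]
  calc ∑' i, ENNReal.ofReal (‖S (b i)‖ ^ 2)
      = ∑' i, ∑' j, ENNReal.ofReal (‖⟪c j, S (b i)⟫_ℂ‖ ^ 2) := by
        simp_rw [← ofReal_norm_sq_eq_tsum c]
    _ = ∑' j, ∑' i, ENNReal.ofReal (‖⟪c j, S (b i)⟫_ℂ‖ ^ 2) := ENNReal.tsum_comm
    _ = ∑' j, ∑' i, ENNReal.ofReal (‖⟪b i, S (c j)⟫_ℂ‖ ^ 2) := by
        simp_rw [key, norm_inner_symm]
        simp_rw [← key]
    _ = _ := by simp_rw [← ofReal_norm_sq_eq_tsum b]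

/-- The trace of a positive operator can be computed in any Hilbert basis. -/
theorem posTrace_eq {ι : Type*} (b : HilbertBasis ι ℂ H) {P : H →L[ℂ] H} (hP : P.IsPositive) :
    posTrace P = ∑' i, ENNReal.ofReal (⟪b i, P (b i)⟫_ℂ).re :=
  posTrace_aux _ _ hP

theorem inner_eq_ofReal {P : H →L[ℂ] H} (hP : P.IsPositive) (x : H) :
    ⟪x, P x⟫_ℂ = ((⟪x, P x⟫_ℂ).re : ℂ) :=
  (Complex.eq_re_of_ofReal_le (r := 0) (by simpa using hP.inner_nonneg_right x))

theorem re_inner_nonneg' {P : H →L[ℂ] H} (hP : P.IsPositive) (x : H) :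
    0 ≤ (⟪x, P x⟫_ℂ).re := hP.re_inner_nonneg_right x

theorem hasSum_posTrace {ι : Type*} (b : HilbertBasis ι ℂ H) {P : H →L[ℂ] H}
    (hP : P.IsPositive) (h : posTrace P ≠ ⊤) :
    HasSum (fun i => ⟪b i, P (b i)⟫_ℂ) ((posTrace P).toReal : ℂ) := by
  rw [posTrace_eq b hP] at h ⊢
  have hs := ENNReal.summable_toReal h
  have := hs.hasSum
  simp_rw [ENNReal.toReal_ofReal (re_inner_nonneg' hP _)] at this
  rw [ENNReal.tsum_toReal_eq (fun _ => ENNReal.ofReal_ne_top)]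
  simp_rw [ENNReal.toReal_ofReal (re_inner_nonneg' hP _)]
  have h2 := Complex.hasSum_ofReal.2 this
  simp_rw [← inner_eq_ofReal hP] at h2
  exact h2

/-- The trace `∑ᵢ ⟨bᵢ, T bᵢ⟩` of an operator; a convergent, basis independent sum if `T` is of
trace class. -/
def trace (T : H →L[ℂ] H) : ℂ := ∑' i, ⟪stdBasis H i, T (stdBasis H i)⟫_ℂ

/-- For trace class operators the sum defining the trace converges, with the same value, in any
Hilbert basis. -/
theorem hasSum_trace {ι : Type*} (b : HilbertBasis ι ℂ H) {T : H →L[ℂ] H}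
    (hT : T ∈ TraceClass H) : HasSum (fun i => ⟪b i, T (b i)⟫_ℂ) (trace T) := by
  suffices h : ∃ t : ℂ, HasSum (fun i => ⟪stdBasis H i, T (stdBasis H i)⟫_ℂ) t ∧
      HasSum (fun i => ⟪b i, T (b i)⟫_ℂ) t by
    obtain ⟨t, h1, h2⟩ := h
    rwa [trace, h1.tsum_eq]
  induction hT using Submodule.span_induction with
  | mem P hP => exact ⟨_, hasSum_posTrace _ hP.1 hP.2, hasSum_posTrace _ hP.1 hP.2⟩
  | zero => exact ⟨0, by simp, by simp⟩
  | add S T _ _ hS hT =>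
    obtain ⟨s, hs, hs'⟩ := hS
    obtain ⟨t, ht, ht'⟩ := hT
    exact ⟨s + t, by simpa [inner_add_right] using hs.add ht,
      by simpa [inner_add_right] using hs'.add ht'⟩
  | smul c T _ hT =>
    obtain ⟨t, ht, ht'⟩ := hT
    exact ⟨c * t, by simpa [inner_smul_right] using ht.mul_left c,
      by simpa [inner_smul_right] using ht'.mul_left c⟩

theorem trace_add {S T : H →L[ℂ] H} (hS : S ∈ TraceClass H) (hT : T ∈ TraceClass H) :
    trace (S + T) = trace S + trace T := by
  refine HasSum.unique (hasSum_trace (stdBasis H) (add_mem hS hT)) ?_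
  simpa [inner_add_right] using (hasSum_trace (stdBasis H) hS).add (hasSum_trace (stdBasis H) hT)

theorem trace_smul (c : ℂ) (T : H →L[ℂ] H) : trace (c • T) = c * trace T := by
  simp [trace, tsum_mul_left]

theorem mem_traceClass {P : H →L[ℂ] H} (hP : P.IsPositive) (h : posTrace P ≠ ⊤) :
    P ∈ TraceClass H := Submodule.subset_span ⟨hP, h⟩

theorem posTrace_eq_trace {P : H →L[ℂ] H} (hP : P.IsPositive) (h : P ∈ TraceClass H) :
    posTrace P = ENNReal.ofReal (trace P).re := by
  have h1 := Complex.hasSum_re (hasSum_trace (stdBasis H) h)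
  rw [posTrace, ← h1.tsum_eq, ENNReal.ofReal_tsum_of_nonneg (fun _ => re_inner_nonneg' hP _) h1.summable]

theorem isPositive_of_nonneg {P : H →L[ℂ] H} (h : ∀ x, 0 ≤ ⟪x, P x⟫_ℂ) : P.IsPositive := by
  rw [ContinuousLinearMap.isPositive_iff_complex]
  intro x
  have h2 : 0 ≤ ⟪P x, x⟫_ℂ := by
    rw [← inner_conj_symm]; exact star_nonneg_iff.2 (h x)
  obtain ⟨h3, h4⟩ := Complex.nonneg_iff.1 h2
  exact ⟨Complex.ext (by simp) (by simpa using h4), h3⟩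

section Tensor

variable {K : Type*} [NormedAddCommGroup K] [InnerProductSpace ℂ K] [CompleteSpace K]

/-- The Hilbert space tensor product: completion of the algebraic tensor product with respect to
the inner product `⟨a ⊗ u, b ⊗ v⟩ = ⟨a, b⟩ ⟨u, v⟩`. -/
abbrev HTensor (H K : Type*) [NormedAddCommGroup H] [InnerProductSpace ℂ H]
    [NormedAddCommGroup K] [InnerProductSpace ℂ K] : Type _ :=
  UniformSpace.Completion (H ⊗[ℂ] K)

/-- The elementary tensor `x ⊗ y` in the Hilbert space tensor product. -/
def tens (x : H) (y : K) : HTensor H K := ((x ⊗ₜ[ℂ] y : H ⊗[ℂ] K) : HTensor H K)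

theorem inner_tens (x x' : H) (y y' : K) :
    ⟪tens x y, tens x' y'⟫_ℂ = ⟪x, x'⟫_ℂ * ⟪y, y'⟫_ℂ := by
  simp [tens]

theorem norm_tens (x : H) (y : K) : ‖tens x y‖ = ‖x‖ * ‖y‖ := by
  simp [tens]

/-- The bounded operator `x ↦ x ⊗ y`. -/
def inclFst (y : K) : H →L[ℂ] HTensor H K :=
  UniformSpace.Completion.toComplL ∘L (TensorProduct.mkL (𝕜 := ℂ) (E := H) (F := K)).flip y

@[simp] theorem inclFst_apply (y : K) (x : H) : inclFst y x = tens x y := rfl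

theorem inclFst_add (y z : K) : inclFst (H := H) (y + z) = inclFst y + inclFst z := by
  simp [inclFst]

theorem inclFst_smul (c : ℂ) (y : K) : inclFst (H := H) (c • y) = c • inclFst y := by
  simp [inclFst]

theorem tens_add_left (x x' : H) (y : K) : tens (x + x') y = tens x y + tens x' y :=
  (inclFst (H := H) y).map_add x x'

theorem tens_smul_left (c : ℂ) (x : H) (y : K) : tens (c • x) y = c • tens x y :=
  (inclFst (H := H) y).map_smul c x

theorem tens_add_right (x : H) (y y' : K) : tens x (y + y') = tens x y + tens x y' := by
  simpa using DFunLike.congr_fun (inclFst_add (H := H) y y') x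

theorem tens_smul_right (c : ℂ) (x : H) (y : K) : tens x (c • y) = c • tens x y := by
  simpa using DFunLike.congr_fun (inclFst_smul (H := H) c y) x

theorem continuous_tens_right (x : H) : Continuous fun y : K => tens x y :=
  (UniformSpace.Completion.toComplL (𝕜 := ℂ) (E := H ⊗[ℂ] K) ∘L
    (TensorProduct.mkL (𝕜 := ℂ) (E := H) (F := K)) x).continuous

theorem dense_tens (S : Submodule ℂ (HTensor H K)) (h : ∀ x y, tens x y ∈ S.topologicalClosure) :
    S.topologicalClosure = ⊤ := by
  rw [eq_top_iff]
  rintro z -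
  induction z using UniformSpace.Completion.induction_on with
  | hp => exact S.isClosed_topologicalClosure
  | ih z =>
    induction z using TensorProduct.induction_on with
    | zero => rw [UniformSpace.Completion.coe_zero]; exact zero_mem _
    | tmul x y => exact h x y
    | add z w hz hw => rw [UniformSpace.Completion.coe_add]; exact add_mem hz hw

/-- The product of two Hilbert bases. -/
def prodBasis {ι κ : Type*} (a : HilbertBasis ι ℂ H) (g : HilbertBasis κ ℂ K) :
    HilbertBasis (ι × κ) ℂ (HTensor H K) :=
  HilbertBasis.mk (v := fun p : ι × κ => tens (a p.1) (g p.2))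
    (by
      classical
      rw [orthonormal_iff_ite]
      rintro ⟨i, j⟩ ⟨i', j'⟩
      rw [inner_tens, orthonormal_iff_ite.1 a.orthonormal, orthonormal_iff_ite.1 g.orthonormal]
      by_cases h1 : i = i' <;> by_cases h2 : j = j' <;> simp [h1, h2])
    (by
      set S := Submodule.span ℂ (Set.range fun p : ι × κ => tens (a p.1) (g p.2))
      refine (dense_tens S ?_).ge
      have h1 : ∀ i y, tens (a i) y ∈ S.topologicalClosure := by
        intro i y
        have hy : y ∈ (Submodule.span ℂ (Set.range g)).topologicalClosure := by
          rw [g.dense_span]; trivial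
        rw [← SetLike.mem_coe, Submodule.topologicalClosure_coe] at hy
        refine Set.MapsTo.closure (s := (Submodule.span ℂ (Set.range g) : Set K))
          (t := (S : Set (HTensor H K))) ?_ (continuous_tens_right (a i)) hy
        intro y hy
        induction hy using Submodule.span_induction with
        | mem y hy => obtain ⟨j, rfl⟩ := hy; exact Submodule.subset_span ⟨(i, j), rfl⟩
        | zero =>
          have : tens (a i) (0 : K) = 0 := by simpa using tens_smul_right 0 (a i) (0 : K)
          show tens (a i) (0 : K) ∈ (S : Set (HTensor H K))
          rw [this]; exact S.zero_mem
        | add y z _ _ hy hz => simp only [tens_add_right]; exact add_mem hy hz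
        | smul c y _ hy => simp only [tens_smul_right]; exact S.smul_mem c hy
      intro x y
      have hx : x ∈ (Submodule.span ℂ (Set.range a)).topologicalClosure := by
        rw [a.dense_span]; trivial
      rw [← SetLike.mem_coe, Submodule.topologicalClosure_coe] at hx
      have h2 := Set.MapsTo.closure (s := (Submodule.span ℂ (Set.range a) : Set H))
        (t := (S.topologicalClosure : Set (HTensor H K))) (f := fun x => tens x y) ?_
        (inclFst (H := H) y).continuous hx
      · rwa [S.isClosed_topologicalClosure.closure_eq] at h2
      intro x hx
      induction hx using Submodule.span_induction with
      | mem x hx => obtain ⟨i, rfl⟩ := hx; exact h1 i y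
      | zero =>
        have : tens (0 : H) y = 0 := by simpa using tens_smul_left 0 (0 : H) y
        show tens (0 : H) y ∈ S.topologicalClosure
        rw [this]; exact zero_mem _
      | add x z _ _ hx hz => simp only [tens_add_left]; exact add_mem hx hz
      | smul c x _ hx => simp only [tens_smul_left]; exact S.topologicalClosure.smul_mem c hx)

@[simp] theorem prodBasis_apply {ι κ : Type*} (a : HilbertBasis ι ℂ H) (g : HilbertBasis κ ℂ K)
    (p : ι × κ) : prodBasis a g p = tens (a p.1) (g p.2) := by
  simp [prodBasis]

/-- The slice `(1 ⊗ ⟨u|) X (1 ⊗ |v⟩)` of an operator on `H ⊗ K`: the operator on `H` with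
`⟨a, slice u v X b⟩ = ⟨a ⊗ u, X (b ⊗ v)⟩`. -/
def slice (u v : K) (X : HTensor H K →L[ℂ] HTensor H K) : H →L[ℂ] H :=
  (inclFst u).adjoint ∘L X ∘L inclFst v

theorem inner_slice (u v : K) (X : HTensor H K →L[ℂ] HTensor H K) (a b : H) :
    ⟪a, slice u v X b⟫_ℂ = ⟪tens a u, X (tens b v)⟫_ℂ := by
  simp [slice, ContinuousLinearMap.adjoint_inner_right]

theorem op_ext {S T : H →L[ℂ] H} (h : ∀ a b, ⟪a, S b⟫_ℂ = ⟪a, T b⟫_ℂ) : S = T :=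
  ContinuousLinearMap.ext fun b => ext_inner_left ℂ fun a => h a b

theorem slice_add (u v : K) (X Y : HTensor H K →L[ℂ] HTensor H K) :
    slice u v (X + Y) = slice u v X + slice u v Y :=
  op_ext fun a b => by simp [inner_slice, inner_add_right]

theorem slice_smul (u v : K) (c : ℂ) (X : HTensor H K →L[ℂ] HTensor H K) :
    slice u v (c • X) = c • slice u v X :=
  op_ext fun a b => by simp [inner_slice, inner_smul_right]

theorem slice_add_left (u u' v : K) (X : HTensor H K →L[ℂ] HTensor H K) :
    slice (u + u') v X = slice u v X + slice u' v X :=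
  op_ext fun a b => by simp [inner_slice, inner_add_right, inner_add_left, tens_add_right]

theorem slice_add_right (u v v' : K) (X : HTensor H K →L[ℂ] HTensor H K) :
    slice u (v + v') X = slice u v X + slice u v' X :=
  op_ext fun a b => by simp [inner_slice, inner_add_right, tens_add_right]

theorem slice_smul_left (c : ℂ) (u v : K) (X : HTensor H K →L[ℂ] HTensor H K) :
    slice (c • u) v X = (starRingEnd ℂ c) • slice u v X :=
  op_ext fun a b => by simp [inner_slice, inner_smul_right, inner_smul_left, tens_smul_right]

theorem slice_smul_right (c : ℂ) (u v : K) (X : HTensor H K →L[ℂ] HTensor H K) :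
    slice u (c • v) X = c • slice u v X :=
  op_ext fun a b => by simp [inner_slice, inner_smul_right, tens_smul_right]

theorem slice_isPositive {X : HTensor H K →L[ℂ] HTensor H K} (hX : X.IsPositive) (u : K) :
    (slice u u X).IsPositive :=
  isPositive_of_nonneg fun x => by rw [inner_slice]; exact hX.inner_nonneg_right _

theorem posTrace_eq_tsum_slice {κ : Type*} (g : HilbertBasis κ ℂ K)
    {X : HTensor H K →L[ℂ] HTensor H K} (hX : X.IsPositive) :
    posTrace X = ∑' j, posTrace (slice (g j) (g j) X) := by
  rw [posTrace_eq (prodBasis (stdBasis H) g) hX, ENNReal.tsum_prod', ENNReal.tsum_comm]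
  simp [posTrace, inner_slice]

theorem posTrace_sum_slice_le {κ : Type*} [Fintype κ] {g : κ → K} (hg : Orthonormal ℂ g)
    {X : HTensor H K →L[ℂ] HTensor H K} (hX : X.IsPositive) :
    ∑ j, posTrace (slice (g j) (g j) X) ≤ posTrace X := by
  obtain ⟨w, b, hw, hb⟩ := hg.toSubtypeRange.exists_hilbertBasis_extension
  rw [posTrace_eq_tsum_slice b hX]
  have hinj : Function.Injective fun j : κ => (⟨g j, hw ⟨j, rfl⟩⟩ : w) := fun i j h =>
    hg.linearIndependent.injective (by simpa using h)
  have := ENNReal.tsum_comp_le_tsum_of_injective hinj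
    (fun j => posTrace (slice (b j) (b j) X))
  rw [tsum_fintype] at this
  simpa [hb] using this

theorem slice_self_mem {X : HTensor H K →L[ℂ] HTensor H K} (hX : X.IsPositive)
    (h : posTrace X ≠ ⊤) (u : K) : slice u u X ∈ TraceClass H := by
  by_cases hu : u = 0
  · subst hu
    have : slice (0 : K) 0 X = 0 := by simpa using slice_smul_right (0 : ℂ) (0 : K) (0 : K) X
    rw [this]; exact zero_mem _
  set e : K := ((‖u‖ : ℂ)⁻¹) • u with he
  have hn : (‖u‖ : ℂ) ≠ 0 := by simpa using hu
  have hu' : u = (‖u‖ : ℂ) • e := by rw [he, smul_smul, mul_inv_cancel₀ hn, one_smul]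
  have ho : Orthonormal ℂ fun _ : Unit => e := by
    refine ⟨fun _ => ?_, fun i j h => absurd rfl h⟩
    rw [he, norm_smul, norm_inv, Complex.norm_real, norm_norm]
    exact inv_mul_cancel₀ (by simpa using hu)
  have h1 := posTrace_sum_slice_le ho hX
  simp only [Finset.univ_unique, Finset.sum_const, Finset.card_singleton, one_smul] at h1
  have h2 : slice e e X ∈ TraceClass H :=
    mem_traceClass (slice_isPositive hX e) (ne_top_of_le_ne_top h h1)
  rw [hu', slice_smul_left, slice_smul_right]
  exact Submodule.smul_mem _ _ (Submodule.smul_mem _ _ h2)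

theorem slice_polarization (u v : K) (X : HTensor H K →L[ℂ] HTensor H K) :
    (4 : ℂ) • slice u v X = slice (u + v) (u + v) X - slice (u + (-1 : ℂ) • v) (u + (-1 : ℂ) • v) X
      - Complex.I • slice (u + Complex.I • v) (u + Complex.I • v) X
      + Complex.I • slice (u + (-Complex.I) • v) (u + (-Complex.I) • v) X := by
  simp only [slice_add_left, slice_add_right, slice_smul_left, slice_smul_right, map_neg,
    Complex.conj_I, map_one, smul_add, smul_smul]
  have := Complex.I_mul_I
  match_scalars <;> first
    | ring1
    | linear_combination 2 * this
    | linear_combination (-2) * this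

theorem slice_mem {X : HTensor H K →L[ℂ] HTensor H K} (hX : X ∈ TraceClass (HTensor H K))
    (u v : K) : slice u v X ∈ TraceClass H := by
  induction hX using Submodule.span_induction with
  | mem P hP =>
    have h := slice_self_mem hP.1 hP.2
    have h4 : (4 : ℂ) • slice u v P ∈ TraceClass H := by
      rw [slice_polarization]
      exact add_mem (sub_mem (sub_mem (h _) (h _)) (Submodule.smul_mem _ _ (h _)))
        (Submodule.smul_mem _ _ (h _))
    simpa [smul_smul] using Submodule.smul_mem _ (4⁻¹ : ℂ) h4
  | zero => simp [slice]
  | add S T _ _ hS hT => rw [slice_add]; exact add_mem hS hT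
  | smul c T _ hT => rw [slice_smul]; exact Submodule.smul_mem _ _ hT


section Forms

variable {E : Type*} [AddCommGroup E] [Module ℂ E]

theorem form_conj (q : E →ₗ⋆[ℂ] E →ₗ[ℂ] ℂ) (hq : ∀ z, 0 ≤ q z z) (z w : E) :
    starRingEnd ℂ (q w z) = q z w := by
  have him : ∀ z, (q z z).im = 0 := fun z => ((Complex.nonneg_iff.1 (hq z)).2).symm
  have h1 := him (z + w)
  have h2 := him (z + Complex.I • w)
  have hz := him z
  have hw := him w
  simp only [map_add, LinearMap.add_apply, map_smulₛₗ, LinearMap.smul_apply, smul_eq_mul,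
    Complex.conj_I, Complex.add_im, Complex.mul_im, Complex.mul_re, Complex.I_re, Complex.I_im,
    Complex.neg_re, Complex.neg_im, RingHom.id_apply, Complex.add_re] at h1 h2
  apply Complex.ext
  · rw [Complex.conj_re]; linarith
  · rw [Complex.conj_im]; linarith

theorem form_seminorm (q : E →ₗ⋆[ℂ] E →ₗ[ℂ] ℂ) (hq : ∀ z, 0 ≤ q z z) :
    ∃ p : Seminorm ℂ E, (∀ z, p z ^ 2 = (q z z).re) ∧ ∀ z w, ‖q z w‖ ≤ p z * p w := by
  have h0 : ∀ z, 0 ≤ (q z z).re := fun z => (Complex.nonneg_iff.1 (hq z)).1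
  let core : PreInnerProductSpace.Core ℂ E :=
    { inner := fun z w => q z w
      conj_inner_symm := fun z w => form_conj q hq z w
      re_inner_nonneg := h0
      add_left := fun x y z => by simp
      smul_left := fun x y r => by simp }
  let : SeminormedAddCommGroup E := InnerProductSpace.Core.toSeminormedAddCommGroup (𝕜 := ℂ)
  let : NormedSpace ℂ E := InnerProductSpace.Core.toNormedSpace
  exact ⟨normSeminorm ℂ E, fun z => Real.sq_sqrt (h0 z),
    fun z w => InnerProductSpace.Core.norm_inner_le_norm (𝕜 := ℂ) z w⟩

theorem form_sum_le (q : E →ₗ⋆[ℂ] E →ₗ[ℂ] ℂ) (hq : ∀ z, 0 ≤ q z z) {ι : Type*} [Fintype ι]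
    (c : ι → ℂ) (x : ι → E) :
    (q (∑ i, c i • x i) (∑ i, c i • x i)).re ≤ (∑ i, ‖c i‖ ^ 2) * ∑ i, (q (x i) (x i)).re := by
  obtain ⟨p, hp, -⟩ := form_seminorm q hq
  simp_rw [← hp]
  have h1 : p (∑ i, c i • x i) ≤ ∑ i, ‖c i‖ * p (x i) := by
    refine (Finset.le_sum_of_subadditive p (map_zero p).le (map_add_le_add p) _ _).trans ?_
    simp [map_smul_eq_mul]
  calc p (∑ i, c i • x i) ^ 2 ≤ (∑ i, ‖c i‖ * p (x i)) ^ 2 := by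
        gcongr
    _ ≤ _ := Finset.sum_mul_sq_le_sq_mul_sq _ _ _

end Forms

theorem exists_op_of_form {E : Type*} [NormedAddCommGroup E] [InnerProductSpace ℂ E]
    (j : E →ₗᵢ[ℂ] H) (hj : DenseRange j) (q : E →ₗ⋆[ℂ] E →ₗ[ℂ] ℂ) (hq : ∀ z, 0 ≤ q z z)
    (C : ℝ) (hC : ∀ z, (q z z).re ≤ C * ‖z‖ ^ 2) :
    ∃ Y : H →L[ℂ] H, Y.IsPositive ∧ ∀ z w, ⟪j z, Y (j w)⟫_ℂ = q z w := by
  obtain ⟨p, hp, hp2⟩ := form_seminorm q hq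
  set D : ℝ := max C 0
  have hD : 0 ≤ D := le_max_right _ _
  have hpD : ∀ z, p z ≤ √D * ‖z‖ := fun z => by
    refine abs_le_of_sq_le_sq' ?_ (by positivity) |>.2
    rw [hp, mul_pow, Real.sq_sqrt hD]
    exact (hC z).trans (by gcongr; exact le_max_left _ _)
  have hb : ∀ z w, ‖q z w‖ ≤ D * ‖z‖ * ‖w‖ := fun z w => by
    calc ‖q z w‖ ≤ p z * p w := hp2 z w
      _ ≤ (√D * ‖z‖) * (√D * ‖w‖) := by gcongr <;> exact hpD _
      _ = (√D * √D) * ‖z‖ * ‖w‖ := by ring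
      _ = _ := by rw [Real.mul_self_sqrt hD]
  let e : E →L[ℂ] H := j.toContinuousLinearMap
  have he : DenseRange e := hj
  have he' : IsUniformInducing e := j.isometry.isUniformInducing
  have he'' : ∀ x, ‖x‖ ≤ (1 : NNReal) * ‖e x‖ := fun x => by simp [e]
  let B := q.mkContinuous₂ D hb
  let F : E → H := fun w => (InnerProductSpace.toDual ℂ H).symm ((B w).extend e)
  have hF : ∀ w z, ⟪F w, j z⟫_ℂ = q w z := fun w z => by
    simp only [F, InnerProductSpace.toDual_symm_apply]
    exact ContinuousLinearMap.extend_eq (B w) he he' z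
  have hF' : ∀ w w', (∀ z, ⟪w, j z⟫_ℂ = ⟪w', j z⟫_ℂ) → w = w' := fun w w' h => by
    refine ext_inner_right ℂ fun v => ?_
    exact hj.induction_on (p := fun v => ⟪w, v⟫_ℂ = ⟪w', v⟫_ℂ) v
      (isClosed_eq (by fun_prop) (by fun_prop)) h
  let G : E →L[ℂ] H := LinearMap.mkContinuous
    { toFun := F
      map_add' := fun w w' => hF' _ _ fun z => by simp [inner_add_left, hF]
      map_smul' := fun c w => hF' _ _ fun z => by simp [inner_smul_left, hF, mul_comm] } D
    (fun w => by
      have h1 := (B w).opNorm_extend_le he he''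
      have h2 : ‖B w‖ ≤ D * ‖w‖ :=
        ContinuousLinearMap.opNorm_le_bound _ (by positivity) fun z => hb w z
      show ‖F w‖ ≤ _
      simp only [F, LinearIsometryEquiv.norm_map]
      simpa using h1.trans (by simpa using h2))
  have hY : ∀ z w, ⟪j z, G.extend e (j w)⟫_ℂ = q z w := fun z w => by
    have : G.extend e (j w) = F w := ContinuousLinearMap.extend_eq G he he' w
    rw [this, ← inner_conj_symm, hF, form_conj q hq]
  refine ⟨G.extend e, isPositive_of_nonneg fun x => ?_, hY⟩
  refine hj.induction_on (p := fun x => 0 ≤ ⟪x, G.extend e x⟫_ℂ) x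
    (isClosed_le (by fun_prop) (by fun_prop)) fun z => ?_
  rw [hY]; exact hq z

theorem sum_le_posTrace {ι : Type*} [Fintype ι] {f : ι → H} (hf : Orthonormal ℂ f)
    {P : H →L[ℂ] H} (hP : P.IsPositive) :
    ∑ i, ENNReal.ofReal (⟪f i, P (f i)⟫_ℂ).re ≤ posTrace P := by
  obtain ⟨w, b, hw, hb⟩ := hf.toSubtypeRange.exists_hilbertBasis_extension
  rw [posTrace_eq b hP]
  have hinj : Function.Injective fun j : ι => (⟨f j, hw ⟨j, rfl⟩⟩ : w) := fun i j h =>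
    hf.linearIndependent.injective (by simpa using h)
  have := ENNReal.tsum_comp_le_tsum_of_injective hinj
    (fun j => ENNReal.ofReal (⟪b j, P (b j)⟫_ℂ).re)
  rw [tsum_fintype] at this
  simpa [hb] using this

theorem trace_nonneg {P : H →L[ℂ] H} (hP : P.IsPositive) (h : P ∈ TraceClass H) : 0 ≤ trace P :=
  (hasSum_trace (stdBasis H) h).nonneg fun _ => hP.inner_nonneg_right _

theorem tens_ext {X Y : HTensor H K →L[ℂ] HTensor H K}
    (h : ∀ u v, slice u v X = slice u v Y) : X = Y := by
  have h1 : ∀ b v, X (tens b v) = Y (tens b v) := by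
    intro b v
    refine ext_inner_left ℂ fun z => ?_
    have hz : z ∈ (⊤ : Submodule ℂ (HTensor H K)) := trivial
    let S : Submodule ℂ (HTensor H K) := (ℂ ∙ (X (tens b v) - Y (tens b v)))ᗮ
    have hS : S.topologicalClosure = ⊤ := dense_tens S fun a u =>
      S.le_topologicalClosure (by
        rw [Submodule.mem_orthogonal_singleton_iff_inner_left, inner_sub_right, ← inner_slice,
          ← inner_slice, h, sub_self])
    rw [(Submodule.isClosed_orthogonal _).submodule_topologicalClosure_eq] at hS
    rw [← hS, Submodule.mem_orthogonal_singleton_iff_inner_left, inner_sub_right] at hz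
    exact sub_eq_zero.1 hz
  let S : Submodule ℂ (HTensor H K) := LinearMap.ker ((X - Y : HTensor H K →L[ℂ] HTensor H K) :
    HTensor H K →ₗ[ℂ] HTensor H K)
  have hS : S.topologicalClosure = ⊤ := dense_tens S fun b v =>
    S.le_topologicalClosure (by simp [S, h1])
  have hc : IsClosed (S : Set (HTensor H K)) := (X - Y).isClosed_ker
  rw [hc.submodule_topologicalClosure_eq] at hS
  ext z
  have hz : z ∈ (⊤ : Submodule ℂ (HTensor H K)) := trivial
  rw [← hS] at hz
  exact sub_eq_zero.1 (by simpa [S] using hz)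

/-- The slice of a trace class operator on `H ⊗ K`, as a trace class operator on `H`. -/
def sliceTC (u v : K) (X : TraceClass (HTensor H K)) : TraceClass H :=
  ⟨slice u v (X : HTensor H K →L[ℂ] HTensor H K), slice_mem X.2 u v⟩

theorem exists_ptrace_aux {X : HTensor H K →L[ℂ] HTensor H K} (hX : X ∈ TraceClass (HTensor H K)) :
    ∃ Y ∈ TraceClass K, ∀ u v : K, ⟪u, Y v⟫_ℂ = trace (slice u v X) := by
  induction hX using Submodule.span_induction with
  | mem P hP =>
    have hm : P ∈ TraceClass (HTensor H K) := mem_traceClass hP.1 hP.2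
    let q : K →ₗ⋆[ℂ] K →ₗ[ℂ] ℂ := LinearMap.mk₂'ₛₗ (starRingEnd ℂ) (RingHom.id ℂ)
      (fun u v => trace (slice u v P))
      (fun u u' v => by rw [slice_add_left, trace_add (slice_mem hm _ _) (slice_mem hm _ _)])
      (fun c u v => by rw [slice_smul_left, trace_smul, smul_eq_mul])
      (fun u v v' => by rw [slice_add_right, trace_add (slice_mem hm _ _) (slice_mem hm _ _)])
      (fun c u v => by rw [slice_smul_right, trace_smul]; rfl)
    have hqa : ∀ u v, q u v = trace (slice u v P) := fun u v => rfl
    have hq : ∀ u, 0 ≤ q u u := fun u =>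
      trace_nonneg (slice_isPositive hP.1 u) (slice_mem hm u u)
    obtain ⟨Y, hY, hYq⟩ := exists_op_of_form (LinearIsometry.id (R := ℂ) (E := K))
      denseRange_id q hq (posTrace P).toReal (fun u => by
        by_cases hu : u = 0
        · simp [hu]
        have hn : (‖u‖ : ℂ) ≠ 0 := by simpa using hu
        have ho : Orthonormal ℂ fun _ : Unit => ((‖u‖ : ℂ)⁻¹) • u := by
          refine ⟨fun _ => ?_, fun i j h => absurd rfl h⟩
          rw [norm_smul, norm_inv, Complex.norm_real, norm_norm]
          exact inv_mul_cancel₀ (by simpa using hu)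
        have h1 := posTrace_sum_slice_le ho hP.1
        simp only [Finset.univ_unique, Finset.sum_const, Finset.card_singleton, one_smul] at h1
        rw [posTrace_eq_trace (slice_isPositive hP.1 _) (slice_mem hm _ _),
          ← ENNReal.ofReal_toReal hP.2, ENNReal.ofReal_le_ofReal_iff ENNReal.toReal_nonneg] at h1
        have hu' : u = (‖u‖ : ℂ) • ((‖u‖ : ℂ)⁻¹ • u) := by
          rw [smul_smul, mul_inv_cancel₀ hn, one_smul]
        rw [hqa]
        set e := ((‖u‖ : ℂ)⁻¹) • u
        have h2 : trace (slice u u P) = ((‖u‖ ^ 2 : ℝ) : ℂ) * trace (slice e e P) := by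
          conv_lhs => rw [hu']
          rw [slice_smul_left, slice_smul_right, trace_smul, trace_smul, Complex.conj_ofReal,
            ← mul_assoc]
          push_cast; ring
        rw [h2, Complex.re_ofReal_mul, mul_comm]
        gcongr)
    refine ⟨Y, mem_traceClass hY ?_, fun u v => hYq u v⟩
    have : posTrace Y = posTrace P := by
      rw [posTrace_eq_tsum_slice (stdBasis K) hP.1, posTrace]
      congr 1; funext i
      rw [posTrace_eq_trace (slice_isPositive hP.1 _) (slice_mem hm _ _)]
      congr 2
      exact hYq _ _
    rw [this]; exact hP.2
  | zero => exact ⟨0, zero_mem _, fun u v => by simp [slice, trace]⟩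
  | add S T hS' hT' hS hT =>
    obtain ⟨Y, hY, h1⟩ := hS
    obtain ⟨Z, hZ, h2⟩ := hT
    exact ⟨Y + Z, add_mem hY hZ, fun u v => by
      rw [slice_add, trace_add (slice_mem hS' _ _) (slice_mem hT' _ _), ← h1, ← h2]
      simp [inner_add_right]⟩
  | smul c T _ hT =>
    obtain ⟨Y, hY, h1⟩ := hT
    exact ⟨c • Y, Submodule.smul_mem _ _ hY, fun u v => by
      rw [slice_smul, trace_smul, ← h1]; simp [inner_smul_right]⟩

theorem exists_ptrace (X : TraceClass (HTensor H K)) : ∃ Y : TraceClass K, ∀ u v : K,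
    ⟪u, (Y : K →L[ℂ] K) v⟫_ℂ =
      trace (slice u v (X : HTensor H K →L[ℂ] HTensor H K)) :=
  let ⟨Y, hY, h⟩ := exists_ptrace_aux X.2
  ⟨⟨Y, hY⟩, h⟩

/-- The partial trace over the first factor of a trace class operator `X` on `H ⊗ K`: the
trace class operator on `K` with `⟨u, (tr₁ X) v⟩ = ∑ᵢ ⟨bᵢ ⊗ u, X (bᵢ ⊗ v)⟩`. -/
def ptraceFst (X : TraceClass (HTensor H K)) : TraceClass K := (exists_ptrace X).choose

theorem inner_ptraceFst (X : TraceClass (HTensor H K)) (u v : K) :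
    ⟪u, (ptraceFst X : K →L[ℂ] K) v⟫_ℂ =
      trace (slice u v (X : HTensor H K →L[ℂ] HTensor H K)) :=
  (exists_ptrace X).choose_spec u v


/-- A square matrix of operators on `H` is positive if it is a positive operator on `Hⁿ`. -/
def IsPosMatrix {n : ℕ} (S : Fin n → Fin n → (H →L[ℂ] H)) : Prop :=
  ∀ x : Fin n → H, 0 ≤ ∑ i, ∑ j, ⟪x i, S i j (x j)⟫_ℂ

/-- A quantum channel (Schrödinger picture) from `H` to `H'`: a completely positive trace
preserving linear map from the trace class on `H` to the trace class on `H'`. -/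
@[ext]
structure Channel (H H' : Type*) [NormedAddCommGroup H] [InnerProductSpace ℂ H] [CompleteSpace H]
    [NormedAddCommGroup H'] [InnerProductSpace ℂ H'] [CompleteSpace H'] where
  /-- the underlying linear map -/
  toLin : TraceClass H →ₗ[ℂ] TraceClass H'
  completelyPositive : ∀ (n : ℕ) (S : Fin n → Fin n → TraceClass H),
    IsPosMatrix (fun i j => (S i j : H →L[ℂ] H)) →
      IsPosMatrix (fun i j => (toLin (S i j) : H' →L[ℂ] H'))
  tracePreserving : ∀ S : TraceClass H,
    trace (toLin S : H' →L[ℂ] H') = trace (S : H →L[ℂ] H)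

namespace Channel

variable {H' : Type*} [NormedAddCommGroup H'] [InnerProductSpace ℂ H'] [CompleteSpace H']

theorem isPositive (T : Channel H H') {S : TraceClass H} (hS : (S : H →L[ℂ] H).IsPositive) :
    (T.toLin S : H' →L[ℂ] H').IsPositive :=
  isPositive_of_nonneg fun x => by
    have := T.completelyPositive 1 (fun _ _ => S)
      (fun x => by simpa using hS.inner_nonneg_right (x 0)) (fun _ => x)
    simpa using this

theorem posTrace_eq (T : Channel H H') {S : TraceClass H} (hS : (S : H →L[ℂ] H).IsPositive) :
    posTrace (T.toLin S : H' →L[ℂ] H') = posTrace (S : H →L[ℂ] H) := by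
  rw [posTrace_eq_trace (T.isPositive hS) (T.toLin S).2, posTrace_eq_trace hS S.2,
    T.tracePreserving]

theorem isPosMatrix_slice {X : TraceClass (HTensor H K)}
    (hX : (X : HTensor H K →L[ℂ] HTensor H K).IsPositive) {n : ℕ} (u : Fin n → K) :
    IsPosMatrix (fun i j => (sliceTC (u i) (u j) X : H →L[ℂ] H)) := by
  intro x
  have := hX.inner_nonneg_right (∑ i, tens (x i) (u i))
  simp only [map_sum, sum_inner, inner_sum] at this
  rw [Finset.sum_comm] at this
  simpa [sliceTC, inner_slice] using this

/-- The sesquilinear form `⟨a ⊗ u, b ⊗ v⟩ ↦ ⟨a, T(slice u v X) b⟩`. -/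
def form (T : Channel H H') (X : TraceClass (HTensor H K)) :
    (H' ⊗[ℂ] K) →ₗ⋆[ℂ] (H' ⊗[ℂ] K) →ₗ[ℂ] ℂ :=
  TensorProduct.lift (LinearMap.mk₂'ₛₗ (starRingEnd ℂ) (starRingEnd ℂ)
    (fun (a : H') (u : K) => TensorProduct.lift (LinearMap.mk₂ ℂ
      (fun (b : H') (v : K) => ⟪a, (T.toLin (sliceTC u v X) : H' →L[ℂ] H') b⟫_ℂ)
      (fun b b' v => by simp [inner_add_right])
      (fun c b v => by simp [inner_smul_right])
      (fun b v v' => by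
        have : sliceTC u (v + v') X = sliceTC u v X + sliceTC u v' X :=
          Subtype.ext (slice_add_right _ _ _ _)
        simp [this, inner_add_right])
      (fun c b v => by
        have : sliceTC u (c • v) X = c • sliceTC u v X :=
          Subtype.ext (slice_smul_right _ _ _ _)
        simp [this, inner_smul_right])))
    (fun a a' u => by
      apply TensorProduct.ext'
      intro b v
      simp [inner_add_left])
    (fun c a u => by
      apply TensorProduct.ext'
      intro b v
      simp [inner_smul_left, mul_comm])
    (fun a u u' => by
      apply TensorProduct.ext'
      intro b v
      have : sliceTC (u + u') v X = sliceTC u v X + sliceTC u' v X :=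
        Subtype.ext (slice_add_left _ _ _ _)
      simp [this, inner_add_right])
    (fun c a u => by
      apply TensorProduct.ext'
      intro b v
      have : sliceTC (c • u) v X = (starRingEnd ℂ c) • sliceTC u v X :=
        Subtype.ext (slice_smul_left _ _ _ _)
      simp [this, inner_smul_right]))

theorem form_tmul (T : Channel H H') (X : TraceClass (HTensor H K)) (a b : H') (u v : K) :
    T.form X (a ⊗ₜ u) (b ⊗ₜ v) = ⟪a, (T.toLin (sliceTC u v X) : H' →L[ℂ] H') b⟫_ℂ := by
  simp [form]

theorem form_nonneg (T : Channel H H') {X : TraceClass (HTensor H K)}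
    (hX : (X : HTensor H K →L[ℂ] HTensor H K).IsPositive) (z : H' ⊗[ℂ] K) :
    0 ≤ T.form X z z := by
  obtain ⟨n, a, u, rfl⟩ := TensorProduct.exists_sum_tmul_eq z
  have := T.completelyPositive n _ (isPosMatrix_slice hX u) a
  simp only [map_sum, LinearMap.sum_apply, form_tmul]
  rwa [Finset.sum_comm]

theorem form_le (T : Channel H H') {X : TraceClass (HTensor H K)}
    (hX : (X : HTensor H K →L[ℂ] HTensor H K).IsPositive)
    (h : posTrace (X : HTensor H K →L[ℂ] HTensor H K) ≠ ⊤) (z : H' ⊗[ℂ] K) :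
    (T.form X z z).re ≤
      (posTrace (X : HTensor H K →L[ℂ] HTensor H K)).toReal * ‖z‖ ^ 2 := by
  classical
  obtain ⟨E', F', iE', iF', hz⟩ :=
    TensorProduct.exists_finite_submodule_of_setFinite {z} (Set.finite_singleton z)
  obtain ⟨y, rfl⟩ := Set.singleton_subset_iff.mp hz
  set e := stdOrthonormalBasis ℂ E'
  set f := stdOrthonormalBasis ℂ F'
  let ι := Fin (Module.finrank ℂ E')
  let κ := Fin (Module.finrank ℂ F')
  set c : ι × κ → ℂ := fun p => (e.toBasis.tensorProduct f.toBasis).repr y p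
  have hy : TensorProduct.mapIncl E' F' y =
      ∑ p : ι × κ, c p • ((e p.1 : H') ⊗ₜ[ℂ] (f p.2 : K)) := by
    conv_lhs => rw [← (e.toBasis.tensorProduct f.toBasis).sum_repr y]
    simp [c, Module.Basis.tensorProduct_apply', TensorProduct.mapIncl]
    rfl
  have he : Orthonormal ℂ fun i => (e i : H') := e.orthonormal.comp_linearIsometry E'.subtypeₗᵢ
  have hf : Orthonormal ℂ fun i => (f i : K) := f.orthonormal.comp_linearIsometry F'.subtypeₗᵢ
  have hn : ‖TensorProduct.mapIncl E' F' y‖ ^ 2 = ∑ p, ‖c p‖ ^ 2 := by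
    have ho : Orthonormal ℂ fun p : ι × κ => (e p.1 : H') ⊗ₜ[ℂ] (f p.2 : K) := by
      rw [orthonormal_iff_ite]
      rintro ⟨i, j⟩ ⟨i', j'⟩
      rw [TensorProduct.inner_tmul, orthonormal_iff_ite.1 he, orthonormal_iff_ite.1 hf]
      by_cases h1 : i = i' <;> by_cases h2 : j = j' <;> simp [h1, h2]
    rw [hy, @norm_sq_eq_re_inner ℂ, ho.inner_sum]
    rw [map_sum]
    refine Finset.sum_congr rfl fun p _ => ?_
    rw [← Complex.normSq_eq_conj_mul_self, Complex.normSq_eq_norm_sq]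
    exact Complex.ofReal_re _
  rw [hn, hy, mul_comm]
  refine (form_sum_le (T.form X) (T.form_nonneg hX) c _).trans ?_
  gcongr
  simp only [form_tmul]
  have hp : ∀ j, (slice (f j : K) (f j : K)
      (X : HTensor H K →L[ℂ] HTensor H K)).IsPositive := fun j => slice_isPositive hX _
  have hp' : ∀ j, (T.toLin (sliceTC (f j : K) (f j : K) X) : H' →L[ℂ] H').IsPositive :=
    fun j => T.isPositive (hp j)
  rw [← ENNReal.ofReal_le_ofReal_iff ENNReal.toReal_nonneg, ENNReal.ofReal_toReal h,
    ENNReal.ofReal_sum_of_nonneg (fun p _ => re_inner_nonneg' (hp' p.2) _),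
    Fintype.sum_prod_type_right]
  refine (Finset.sum_le_sum fun j _ => sum_le_posTrace he (hp' j)).trans ?_
  refine (Finset.sum_le_sum fun j _ => (T.posTrace_eq (hp j)).le).trans ?_
  exact posTrace_sum_slice_le hf hX

theorem exists_tensorId_aux (T : Channel H H') {X : HTensor H K →L[ℂ] HTensor H K}
    (hX : X ∈ TraceClass (HTensor H K)) : ∃ Y : TraceClass (HTensor H' K),
      ∀ u v, sliceTC u v Y = T.toLin (sliceTC u v ⟨X, hX⟩) := by
  induction hX using Submodule.span_induction with
  | mem P hP =>
    have hm : P ∈ TraceClass (HTensor H K) := mem_traceClass hP.1 hP.2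
    let X : TraceClass (HTensor H K) := ⟨P, hm⟩
    obtain ⟨Y, hY, hYq⟩ := exists_op_of_form
      (UniformSpace.Completion.toComplₗᵢ (𝕜 := ℂ) (E := H' ⊗[ℂ] K))
      UniformSpace.Completion.denseRange_coe (T.form X) (T.form_nonneg hP.1) _
      (T.form_le hP.1 hP.2)
    have hs : ∀ u v, slice u v Y = (T.toLin (sliceTC u v X) : H' →L[ℂ] H') := fun u v =>
      op_ext fun a b => by
        rw [inner_slice, ← form_tmul]; exact hYq _ _
    refine ⟨⟨Y, mem_traceClass hY ?_⟩, fun u v => Subtype.ext (hs u v)⟩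
    have : posTrace Y = posTrace P := by
      rw [posTrace_eq_tsum_slice (stdBasis K) hP.1, posTrace_eq_tsum_slice (stdBasis K) hY]
      congr 1; funext i
      rw [hs]
      exact T.posTrace_eq (S := sliceTC _ _ X) (slice_isPositive hP.1 _)
    rw [this]; exact hP.2
  | zero =>
    refine ⟨0, fun u v => ?_⟩
    have h1 : sliceTC u v (⟨0, zero_mem _⟩ : TraceClass (HTensor H K)) = 0 :=
      Subtype.ext (by simp [sliceTC, slice])
    have h2 : sliceTC u v (0 : TraceClass (HTensor H' K)) = 0 :=
      Subtype.ext (by simp [sliceTC, slice])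
    rw [h2, h1, map_zero]
  | add A B hA hB ihA ihB =>
    obtain ⟨Y, hY⟩ := ihA
    obtain ⟨Z, hZ⟩ := ihB
    refine ⟨Y + Z, fun u v => ?_⟩
    have h1 : sliceTC u v (⟨A + B, add_mem hA hB⟩ : TraceClass (HTensor H K)) =
        sliceTC u v ⟨A, hA⟩ + sliceTC u v ⟨B, hB⟩ := Subtype.ext (slice_add _ _ _ _)
    have h2 : sliceTC u v (Y + Z) = sliceTC u v Y + sliceTC u v Z :=
      Subtype.ext (slice_add _ _ _ _)
    rw [h2, hY, hZ, ← map_add, ← h1]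
  | smul c A hA ihA =>
    obtain ⟨Y, hY⟩ := ihA
    refine ⟨c • Y, fun u v => ?_⟩
    have h1 : sliceTC u v (⟨c • A, Submodule.smul_mem _ c hA⟩ : TraceClass (HTensor H K)) =
        c • sliceTC u v ⟨A, hA⟩ := Subtype.ext (slice_smul _ _ _ _)
    have h2 : sliceTC u v (c • Y) = c • sliceTC u v Y := Subtype.ext (slice_smul _ _ _ _)
    rw [h2, hY, ← map_smul, ← h1]

theorem exists_tensorId (T : Channel H H') (X : TraceClass (HTensor H K)) :
    ∃ Y : TraceClass (HTensor H' K), ∀ u v, sliceTC u v Y = T.toLin (sliceTC u v X) :=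
  T.exists_tensorId_aux X.2

/-- The map `T ⊗ Id` on the trace class of `H ⊗ K`: it applies `T` to every slice, that is,
`⟨a ⊗ u, (T ⊗ Id)(X) (b ⊗ v)⟩ = ⟨a, T((1 ⊗ ⟨u|) X (1 ⊗ |v⟩)) b⟩`, and these matrix elements
determine it. -/
def tensorId (T : Channel H H') (X : TraceClass (HTensor H K)) : TraceClass (HTensor H' K) :=
  (T.exists_tensorId X).choose

theorem sliceTC_tensorId (T : Channel H H') (X : TraceClass (HTensor H K)) (u v : K) :
    sliceTC u v (T.tensorId X) = T.toLin (sliceTC u v X) :=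
  (T.exists_tensorId X).choose_spec u v

theorem eq_tensorId (T : Channel H H') (X : TraceClass (HTensor H K))
    (Y : TraceClass (HTensor H' K)) (h : ∀ u v, sliceTC u v Y = T.toLin (sliceTC u v X)) :
    Y = T.tensorId X :=
  Subtype.ext (tens_ext fun u v =>
    congrArg Subtype.val ((h u v).trans (T.sliceTC_tensorId X u v).symm))

/-- `(T ⊗ Id)(S ⊗ R) = T(S) ⊗ R`, in terms of matrix elements. -/
theorem inner_tensorId_of_product (T : Channel H H') (S : TraceClass H) (R : K →L[ℂ] K)
    (X : TraceClass (HTensor H K))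
    (hX : ∀ b v, (X : HTensor H K →L[ℂ] HTensor H K) (tens b v) =
      tens ((S : H →L[ℂ] H) b) (R v)) (a b : H') (u v : K) :
    ⟪tens a u, (T.tensorId X : HTensor H' K →L[ℂ] HTensor H' K) (tens b v)⟫_ℂ =
      ⟪tens a u, tens ((T.toLin S : H' →L[ℂ] H') b) (R v)⟫_ℂ := by
  have h1 : sliceTC u v X = ⟪u, R v⟫_ℂ • S := Subtype.ext (op_ext fun a b => by
    show ⟪a, slice u v _ b⟫_ℂ = _
    rw [inner_slice, hX, inner_tens]
    simp [inner_smul_right, mul_comm])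
  have h2 : (slice u v (T.tensorId X : HTensor H' K →L[ℂ] HTensor H' K)) =
      ((⟪u, R v⟫_ℂ • T.toLin S : TraceClass H') : H' →L[ℂ] H') := by
    have := T.sliceTC_tensorId X u v
    rw [h1, map_smul] at this
    exact congrArg Subtype.val this
  rw [← inner_slice, h2, inner_tens]
  simp [inner_smul_right, mul_comm]

end Channel

theorem posTrace_rankOne (x : H) : posTrace (InnerProductSpace.rankOne ℂ x x) ≠ ⊤ := by
  have h : posTrace (InnerProductSpace.rankOne ℂ x x) = ENNReal.ofReal (‖x‖ ^ 2) := by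
    rw [posTrace, ofReal_norm_sq_eq_tsum (stdBasis H)]
    congr 1; funext i
    congr 1
    rw [InnerProductSpace.rankOne_apply, inner_smul_right, ← inner_conj_symm,
      ← Complex.normSq_eq_conj_mul_self, Complex.normSq_eq_norm_sq, norm_inner_symm]
    simp [← Complex.ofReal_pow]
  rw [h]; exact ENNReal.ofReal_ne_top

/-- The operator `|x⟩⟨x|`. -/
def ketBra (x : H) : TraceClass H :=
  ⟨InnerProductSpace.rankOne ℂ x x,
    mem_traceClass (InnerProductSpace.isPositive_rankOne_self x) (posTrace_rankOne x)⟩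

/-- A state (density operator): a positive trace class operator of trace one. -/
def IsState (ρ : TraceClass H) : Prop :=
  (ρ : H →L[ℂ] H).IsPositive ∧ trace (ρ : H →L[ℂ] H) = 1

/-- The canonical purification `∑ₙ √sₙ bₙ ⊗ bₙ` of the state with eigenbasis `b` and
eigenvalues `s`. -/
def purification {ι : Type*} (b : HilbertBasis ι ℂ H) (s : ι → ℝ) : HTensor H H :=
  ∑' n, (√(s n) : ℂ) • tens (b n) (b n)

/-- The series defining the purification of a state converges. -/
theorem hasSum_purification {σ : TraceClass H} (hσ : IsState σ) {ι : Type*}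
    (b : HilbertBasis ι ℂ H) (s : ι → ℝ)
    (hs : ∀ n, (σ : H →L[ℂ] H) (b n) = (s n : ℂ) • b n) :
    HasSum (fun n => (√(s n) : ℂ) • tens (b n) (b n)) (purification b s) := by
  classical
  have h1 : HasSum s 1 := by
    have := hasSum_trace b σ.2
    rw [hσ.2] at this
    have h2 := Complex.hasSum_re this
    simpa [hs, inner_smul_right, b.orthonormal.1] using h2
  have h0 : ∀ n, 0 ≤ s n := fun n => by
    simpa [hs, inner_smul_right, b.orthonormal.1] using re_inner_nonneg' hσ.1 (b n)
  have ho : Orthonormal ℂ fun n => tens (b n) (b n) := by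
    have := (prodBasis b b).orthonormal.comp (fun n => (n, n)) (fun i j h => by simpa using h)
    convert this using 1
    funext n
    simp
  refine Summable.hasSum ?_
  have hl : Memℓp (fun n => (√(s n) : ℂ)) 2 := memℓp_gen (by
    simpa [Real.sq_sqrt (h0 _)] using h1.summable)
  have := ho.orthogonalFamily.summable_of_lp (⟨_, hl⟩ : lp (fun _ : ι => ℂ) 2)
  simpa using this

end Tensor

end QChannel

end

/-! An operator on a tensor product is determined by its slices `slice (b m) (b n)` in a basis of
the second factor. For `|Ω_σ⟩⟨Ω_σ|` these slices are `√(s m) √(s n) |b m⟩⟨b n|`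
(`sliceTC_purification`), so the slices of `ρ = (T ⊗ Id)(|Ω_σ⟩⟨Ω_σ|)` are `√(s m) √(s n) T(|b m⟩⟨b
n|)`. Full rank makes every `s n` positive, hence `ρ` and the values of `T` on the matrix units `|b
m⟩⟨b n|` determine each other. That `ρ` is a state with marginal `σ` follows from complete
positivity and trace preservation.

Injectivity needs a continuity argument, because in infinite dimension the matrix units do not span
the trace class algebraically. Positivity and trace preservation supply it: `⟨a, T(P) a⟩ ≤ tr P ·
‖a‖²` for positive `P`, which passes from matrix units to all `|φ⟩⟨φ|` and from there to all
positive trace class operators (`ext_of_rankOne_basis`).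

For surjectivity, write `ρ = R²` with `R` self-adjoint and put `Wₙ = (s n)^(-1/2) (1 ⊗ ⟨b n|) R`.
Then `Wₘ Wₙ†` is the rescaled slice of `ρ` that `T(|b m⟩⟨b n|)` has to be, and the marginal
condition says exactly that `tr (Wₘ Wₙ†) = δₘₙ`. Viewed as vectors, the Hilbert–Schmidt operators
`Wₙ` are thus orthonormal and define an isometry `V`. The Stinespring form `T(S) = tr_E (V S V†)` is
a channel with the required values (`exists_of_orthonormal_hilbertSchmidt`). No convergence of a
series for `T` has to be discussed separately. -/

noncomputable section

namespace QChannel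

/-! ### Trace class estimates, isometric conjugation and the partial trace -/

section TraceLemmas

variable {H K : Type*}
  [NormedAddCommGroup H] [InnerProductSpace ℂ H] [CompleteSpace H]
  [NormedAddCommGroup K] [InnerProductSpace ℂ K] [CompleteSpace K]

omit [CompleteSpace H] in
theorem op_ext_basis {κ : Type*} (g : HilbertBasis κ ℂ H) {S T : H →L[ℂ] H}
    (h : ∀ i j, ⟪g i, S (g j)⟫_ℂ = ⟪g i, T (g j)⟫_ℂ) : S = T := by
  refine ContinuousLinearMap.ext_on (s := Set.range g) ?_ ?_
  · rw [dense_iff_closure_eq, ← Submodule.topologicalClosure_coe, g.dense_span]; rfl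
  · rintro _ ⟨j, rfl⟩
    refine g.repr.injective (lp.ext (funext fun i => ?_))
    rw [g.repr_apply_apply, g.repr_apply_apply, h]

theorem op_ext_slice_basis {κ : Type*} (g : HilbertBasis κ ℂ K)
    {X Y : HTensor H K →L[ℂ] HTensor H K}
    (h : ∀ m n, slice (g m) (g n) X = slice (g m) (g n) Y) : X = Y :=
  op_ext_basis (prodBasis (stdBasis H) g) fun i j => by
    rw [prodBasis_apply, prodBasis_apply, ← inner_slice, ← inner_slice, h]

/-- Polarization: the trace class is a span of positive operators, so off-diagonal `|x⟩⟨y|` must be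
written through the positive `|z⟩⟨z|`. -/
theorem rankOne_mem_traceClass (x y : H) : InnerProductSpace.rankOne ℂ x y ∈ TraceClass H := by
  have h := fun z : H => (ketBra z).2
  simp only [ketBra] at h
  have h4 : (4 : ℂ) • InnerProductSpace.rankOne ℂ x y ∈ TraceClass H := by
    have e : (4 : ℂ) • InnerProductSpace.rankOne ℂ x y =
        InnerProductSpace.rankOne ℂ (x + y) (x + y)
        - InnerProductSpace.rankOne ℂ (x + (-1 : ℂ) • y) (x + (-1 : ℂ) • y)
        + Complex.I • InnerProductSpace.rankOne ℂ (x + Complex.I • y) (x + Complex.I • y)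
        - Complex.I • InnerProductSpace.rankOne ℂ (x + (-Complex.I) • y)
          (x + (-Complex.I) • y) := by
      simp only [map_add, add_apply, map_smulₛₗ,
        smul_apply, map_neg, RingHom.id_apply,
        Complex.conj_I, map_one, smul_add, smul_smul]
      have := Complex.I_mul_I
      match_scalars <;> first
        | ring1
        | linear_combination 2 * this
        | linear_combination (-2) * this
    rw [e]
    exact sub_mem (add_mem (sub_mem (h _) (h _)) (Submodule.smul_mem _ _ (h _)))
      (Submodule.smul_mem _ _ (h _))
  simpa [smul_smul] using Submodule.smul_mem _ (4⁻¹ : ℂ) h4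

/-- The trace class operator `|x⟩⟨y|`. -/
def rankOneTC (x y : H) : TraceClass H :=
  ⟨InnerProductSpace.rankOne ℂ x y, rankOne_mem_traceClass x y⟩

theorem coe_rankOneTC (x y : H) :
    (rankOneTC x y : H →L[ℂ] H) = InnerProductSpace.rankOne ℂ x y := rfl

theorem trace_rankOneTC (x y : H) : trace (rankOneTC x y : H →L[ℂ] H) = ⟪y, x⟫_ℂ := by
  rw [trace, ← (stdBasis H).tsum_inner_mul_inner]
  simp [coe_rankOneTC, InnerProductSpace.rankOne_apply]

/-- The normalized vector `a / ‖a‖` extends to an orthonormal basis, and its diagonal entry is one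
of the nonnegative terms of the trace. This bound is the source of all continuity of channels below.
-/
theorem inner_le_trace_mul {P : H →L[ℂ] H} (hP : P.IsPositive) (h : P ∈ TraceClass H) (a : H) :
    (⟪a, P a⟫_ℂ).re ≤ (trace P).re * ‖a‖ ^ 2 := by
  by_cases ha : a = 0
  · simp [ha]
  have hn : (‖a‖ : ℂ) ≠ 0 := by simpa using ha
  have ho : Orthonormal ℂ fun _ : Unit => ((‖a‖ : ℂ)⁻¹) • a := by
    refine ⟨fun _ => ?_, fun i j h => absurd rfl h⟩
    rw [norm_smul, norm_inv, Complex.norm_real, norm_norm]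
    exact inv_mul_cancel₀ (by simpa using ha)
  have h1 := sum_le_posTrace ho hP
  have ht : 0 ≤ (trace P).re := (Complex.nonneg_iff.1 (trace_nonneg hP h)).1
  rw [posTrace_eq_trace hP h] at h1
  simp only [Finset.univ_unique, Finset.sum_const, Finset.card_singleton, one_smul] at h1
  rw [ENNReal.ofReal_le_ofReal_iff ht] at h1
  have ha' : a = (‖a‖ : ℂ) • ((‖a‖ : ℂ)⁻¹ • a) := by
    rw [smul_smul, mul_inv_cancel₀ hn, one_smul]
  set e := ((‖a‖ : ℂ)⁻¹) • a
  have h2 : ⟪a, P a⟫_ℂ = ((‖a‖ ^ 2 : ℝ) : ℂ) * ⟪e, P e⟫_ℂ := by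
    conv_lhs => rw [ha']
    rw [map_smul, inner_smul_left, inner_smul_right, Complex.conj_ofReal, ← mul_assoc]
    push_cast; ring
  rw [h2, Complex.re_ofReal_mul, mul_comm]
  gcongr

/-- Both sides are the double sum of the squared moduli of the matrix elements of `A`, summed in the
two possible orders. In `[0, ∞]` the exchange needs no finiteness. -/
theorem posTrace_adjoint_comp (A : H →L[ℂ] K) :
    posTrace (A ∘L A.adjoint) = posTrace (A.adjoint ∘L A) := by
  have e1 : ∀ x : K, (⟪x, (A ∘L A.adjoint) x⟫_ℂ).re = ‖A.adjoint x‖ ^ 2 := fun x => by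
    rw [ContinuousLinearMap.comp_apply, ← ContinuousLinearMap.adjoint_inner_left,
      inner_self_eq_norm_sq_to_K]; norm_cast
  have e2 : ∀ x : H, (⟪x, (A.adjoint ∘L A) x⟫_ℂ).re = ‖A x‖ ^ 2 := fun x => by
    rw [ContinuousLinearMap.comp_apply, ContinuousLinearMap.adjoint_inner_right,
      inner_self_eq_norm_sq_to_K]; norm_cast
  simp_rw [posTrace, e1, e2, ofReal_norm_sq_eq_tsum (stdBasis H) (A.adjoint _),
    ofReal_norm_sq_eq_tsum (stdBasis K) (A _)]
  rw [ENNReal.tsum_comm]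
  simp_rw [ContinuousLinearMap.adjoint_inner_right, norm_inner_symm]

/-- Conjugation with an isometry preserves the trace class and the trace. -/
theorem isometry_conj (V : H →L[ℂ] K) (hV : V.adjoint ∘L V = 1) {P : H →L[ℂ] H}
    (hP : P ∈ TraceClass H) : V ∘L P ∘L V.adjoint ∈ TraceClass K ∧
      trace (V ∘L P ∘L V.adjoint) = trace P := by
  induction hP using Submodule.span_induction with
  | mem P hP =>
    have hpos : (V ∘L P ∘L V.adjoint).IsPositive := hP.1.conj_adjoint V
    have ht : posTrace (V ∘L P ∘L V.adjoint) = posTrace P := by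
      -- With `P = S²`, the conjugate is `(V S)(V S)†`, whose trace equals that of `(V S)†(V S) = S
      -- V†V S = S²`.
      obtain ⟨S, hS, rfl⟩ := exists_sqrt hP.1
      have hS' : S.adjoint = S := hS.adjoint_eq
      have := posTrace_adjoint_comp (V ∘L S)
      rw [ContinuousLinearMap.adjoint_comp, hS'] at this
      have e : (S ∘L V.adjoint) ∘L (V ∘L S) = S * S := by
        calc (S ∘L V.adjoint) ∘L (V ∘L S) = S ∘L (V.adjoint ∘L V) ∘L S := rfl
          _ = _ := by rw [hV]; rfl
      rw [e] at this
      exact this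
    have hm := mem_traceClass hpos (by rw [ht]; exact hP.2)
    refine ⟨hm, ?_⟩
    have h1 := hasSum_posTrace (stdBasis K) hpos (by rw [ht]; exact hP.2)
    have h2 := hasSum_posTrace (stdBasis H) hP.1 hP.2
    rw [trace, trace, h1.tsum_eq, h2.tsum_eq, ht]
  | zero => simp [trace]
  | add S T hS' hT' hS hT =>
    have e : V ∘L (S + T) ∘L V.adjoint = V ∘L S ∘L V.adjoint + V ∘L T ∘L V.adjoint := by
      ext; simp
    rw [e, trace_add hS.1 hT.1, trace_add hS' hT', hS.2, hT.2]
    exact ⟨add_mem hS.1 hT.1, rfl⟩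
  | smul c T _ hT =>
    have e : V ∘L (c • T) ∘L V.adjoint = c • (V ∘L T ∘L V.adjoint) := by
      ext; simp
    rw [e, trace_smul, trace_smul, hT.2]
    exact ⟨Submodule.smul_mem _ _ hT.1, rfl⟩

/-- The trace is a summable series over a product basis; summing first over the `H` index gives the
diagonal entries of the partial trace. -/
theorem trace_ptraceFst (X : TraceClass (HTensor H K)) :
    trace (ptraceFst X : K →L[ℂ] K) = trace (X : HTensor H K →L[ℂ] HTensor H K) := by
  have h1 := hasSum_trace (prodBasis (stdBasis H) (stdBasis K)) X.2
  have h2 := (Equiv.prodComm _ _).hasSum_iff.2 h1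
  have h3 := h2.prod_fiberwise (g := fun j => ⟪stdBasis K j, (ptraceFst X : K →L[ℂ] K)
    (stdBasis K j)⟫_ℂ) fun j => by
      rw [inner_ptraceFst]
      have := hasSum_trace (stdBasis H) (slice_mem X.2 (stdBasis K j) (stdBasis K j))
      simpa [inner_slice] using this
  exact h3.tsum_eq

end TraceLemmas

/-! ### Slices and marginal of the canonical purification -/

section Purification

variable {H K : Type*}
  [NormedAddCommGroup H] [InnerProductSpace ℂ H] [CompleteSpace H]
  [NormedAddCommGroup K] [InnerProductSpace ℂ K] [CompleteSpace K]

theorem eigenvalue_nonneg {σ : TraceClass H} (hσ : IsState σ) {ι : Type*}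
    (b : HilbertBasis ι ℂ H) {s : ι → ℝ}
    (hs : ∀ n, (σ : H →L[ℂ] H) (b n) = (s n : ℂ) • b n) (n : ι) : 0 ≤ s n := by
  simpa [hs, inner_smul_right, b.orthonormal.1] using re_inner_nonneg' hσ.1 (b n)

/-- An eigenvector of eigenvalue zero would be orthogonal to the range of `σ`, which is dense. -/
theorem eigenvalue_pos {σ : TraceClass H} (hσ : IsState σ)
    (hfull : DenseRange (σ : H →L[ℂ] H)) {ι : Type*}
    (b : HilbertBasis ι ℂ H) {s : ι → ℝ}
    (hs : ∀ n, (σ : H →L[ℂ] H) (b n) = (s n : ℂ) • b n) (n : ι) : 0 < s n := by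
  refine lt_of_le_of_ne (eigenvalue_nonneg hσ b hs n) fun h0 => ?_
  have h1 : ∀ x, ⟪b n, x⟫_ℂ = 0 := fun x =>
    hfull.induction_on (p := fun x => ⟪b n, x⟫_ℂ = 0) x
      (isClosed_eq (by fun_prop) (by fun_prop)) fun y => by
        have h2 : ⟪(σ : H →L[ℂ] H) (b n), y⟫_ℂ = ⟪b n, (σ : H →L[ℂ] H) y⟫_ℂ :=
          hσ.1.isSymmetric _ _
        rw [← h2, hs, ← h0]
        simp
  have h3 := h1 (b n)
  rw [inner_self_eq_zero] at h3
  exact b.orthonormal.ne_zero n h3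

theorem inner_tens_purification {σ : TraceClass H} (hσ : IsState σ) {ι : Type*}
    (b : HilbertBasis ι ℂ H) {s : ι → ℝ}
    (hs : ∀ n, (σ : H →L[ℂ] H) (b n) = (s n : ℂ) • b n) (a : H) (m : ι) :
    ⟪tens a (b m), purification b s⟫_ℂ = (√(s m) : ℂ) * ⟪a, b m⟫_ℂ := by
  classical
  have h := (innerSL ℂ (tens a (b m))).hasSum (hasSum_purification hσ b s hs)
  refine h.unique ?_
  have e : (fun n => innerSL ℂ (tens a (b m)) ((√(s n) : ℂ) • tens (b n) (b n))) =
      fun n => if n = m then (√(s m) : ℂ) * ⟪a, b m⟫_ℂ else 0 := by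
    funext n
    rw [innerSL_apply_apply, inner_smul_right, inner_tens, orthonormal_iff_ite.1 b.orthonormal]
    by_cases h : n = m
    · subst h; simp
    · simp [h, Ne.symm h]
  rw [e]
  exact hasSum_ite_eq m _

/-- The heart of the correspondence: the purification contains every matrix unit, weighted by a
factor that is invertible at full rank. -/
theorem sliceTC_purification {σ : TraceClass H} (hσ : IsState σ) {ι : Type*}
    (b : HilbertBasis ι ℂ H) {s : ι → ℝ}
    (hs : ∀ n, (σ : H →L[ℂ] H) (b n) = (s n : ℂ) • b n) (m n : ι) :
    sliceTC (b m) (b n) (ketBra (purification b s)) =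
      ((√(s m) : ℂ) * (√(s n) : ℂ)) • rankOneTC (b m) (b n) := by
  refine Subtype.ext (op_ext fun a c => ?_)
  change ⟪a, slice _ _ _ c⟫_ℂ =
    ⟪a, (((√(s m) : ℂ) * (√(s n) : ℂ)) • InnerProductSpace.rankOne ℂ (b m) (b n)) c⟫_ℂ
  rw [inner_slice]
  simp only [ketBra, InnerProductSpace.rankOne_apply, inner_smul_right, smul_apply]
  rw [inner_tens_purification hσ b hs, ← inner_conj_symm,
    inner_tens_purification hσ b hs, map_mul, Complex.conj_ofReal, inner_conj_symm]
  ring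

theorem ptraceFst_purification {σ : TraceClass H} (hσ : IsState σ) {ι : Type*}
    (b : HilbertBasis ι ℂ H) {s : ι → ℝ}
    (hs : ∀ n, (σ : H →L[ℂ] H) (b n) = (s n : ℂ) • b n) :
    ptraceFst (ketBra (purification b s)) = σ := by
  classical
  refine Subtype.ext (op_ext_basis b fun m n => ?_)
  have h := congrArg (fun S : TraceClass H => trace (S : H →L[ℂ] H))
    (sliceTC_purification hσ b hs m n)
  rw [inner_ptraceFst]
  refine h.trans ?_
  change trace (_ • (rankOneTC (b m) (b n) : H →L[ℂ] H)) = _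
  rw [trace_smul, trace_rankOneTC, hs, inner_smul_right,
    orthonormal_iff_ite.1 b.orthonormal, orthonormal_iff_ite.1 b.orthonormal]
  by_cases h : m = n
  · subst h
    have h0 := Real.mul_self_sqrt (eigenvalue_nonneg hσ b hs m)
    simp [← Complex.ofReal_mul, h0]
  · simp [h, Ne.symm h]

end Purification

/-! ### Positivity and marginal of `T ⊗ Id`; channels are determined by matrix units -/

namespace Channel

variable {H H' K : Type*}
  [NormedAddCommGroup H] [InnerProductSpace ℂ H] [CompleteSpace H]
  [NormedAddCommGroup H'] [InnerProductSpace ℂ H'] [CompleteSpace H']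
  [NormedAddCommGroup K] [InnerProductSpace ℂ K] [CompleteSpace K]

/-- `tensorId` is specified only through its slices. Identifying its matrix elements with `form` on
algebraic tensors makes complete positivity available, and density then gives positivity on the
completion. -/
theorem inner_tensorId (T : Channel H H') (X : TraceClass (HTensor H K)) (z w : H' ⊗[ℂ] K) :
    ⟪(z : HTensor H' K), (T.tensorId X : HTensor H' K →L[ℂ] HTensor H' K) w⟫_ℂ =
      T.form X z w := by
  induction z using TensorProduct.induction_on with
  | zero => simp [UniformSpace.Completion.coe_zero]
  | tmul a u =>
    induction w using TensorProduct.induction_on with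
    | zero => simp [UniformSpace.Completion.coe_zero]
    | tmul b v =>
      rw [form_tmul, ← sliceTC_tensorId]
      exact (inner_slice u v _ a b).symm
    | add w w' h h' => simp [inner_add_right, h, h', UniformSpace.Completion.coe_add]
  | add z z' h h' => simp [inner_add_left, h, h', UniformSpace.Completion.coe_add]

theorem tensorId_isPositive (T : Channel H H') {X : TraceClass (HTensor H K)}
    (hX : (X : HTensor H K →L[ℂ] HTensor H K).IsPositive) :
    (T.tensorId X : HTensor H' K →L[ℂ] HTensor H' K).IsPositive := by
  refine isPositive_of_nonneg fun x => ?_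
  induction x using UniformSpace.Completion.induction_on with
  | hp => exact isClosed_le (by fun_prop) (by fun_prop)
  | ih z => rw [inner_tensorId]; exact T.form_nonneg hX z

theorem ptraceFst_tensorId (T : Channel H H') (X : TraceClass (HTensor H K)) :
    ptraceFst (T.tensorId X) = ptraceFst X := by
  refine Subtype.ext (op_ext fun u v => ?_)
  rw [inner_ptraceFst, inner_ptraceFst]
  refine (congrArg (fun S : TraceClass H' => trace (S : H' →L[ℂ] H'))
    (T.sliceTC_tensorId X u v)).trans ?_
  exact T.tracePreserving _

theorem trace_tensorId (T : Channel H H') (X : TraceClass (HTensor H K)) :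
    trace (T.tensorId X : HTensor H' K →L[ℂ] HTensor H' K) =
      trace (X : HTensor H K →L[ℂ] HTensor H K) := by
  rw [← trace_ptraceFst, ptraceFst_tensorId, trace_ptraceFst]

/-- The sesquilinear form `(ψ, φ) ↦ ⟨a, T(|φ⟩⟨ψ|) a⟩` is given by a bounded operator. -/
theorem exists_dual_op (T : Channel H H') (a : H') :
    ∃ Y : H →L[ℂ] H, ∀ ψ φ,
      ⟪ψ, Y φ⟫_ℂ = ⟪a, (T.toLin (rankOneTC φ ψ) : H' →L[ℂ] H') a⟫_ℂ := by
  have hadd : ∀ φ φ' ψ : H, rankOneTC (φ + φ') ψ = rankOneTC φ ψ + rankOneTC φ' ψ :=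
    fun φ φ' ψ => Subtype.ext (by simp [coe_rankOneTC])
  have hadd' : ∀ φ ψ ψ' : H, rankOneTC φ (ψ + ψ') = rankOneTC φ ψ + rankOneTC φ ψ' :=
    fun φ ψ ψ' => Subtype.ext (by simp [coe_rankOneTC])
  have hsmul : ∀ (c : ℂ) (φ ψ : H), rankOneTC (c • φ) ψ = c • rankOneTC φ ψ :=
    fun c φ ψ => Subtype.ext (by simp [coe_rankOneTC])
  have hsmul' : ∀ (c : ℂ) (φ ψ : H), rankOneTC φ (c • ψ) = starRingEnd ℂ c • rankOneTC φ ψ :=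
    fun c φ ψ => Subtype.ext (by simp [coe_rankOneTC])
  let q : H →ₗ⋆[ℂ] H →ₗ[ℂ] ℂ := LinearMap.mk₂'ₛₗ (starRingEnd ℂ) (RingHom.id ℂ)
    (fun ψ φ => ⟪a, (T.toLin (rankOneTC φ ψ) : H' →L[ℂ] H') a⟫_ℂ)
    (fun ψ ψ' φ => by simp [hadd'])
    (fun c ψ φ => by simp [hsmul'])
    (fun ψ φ φ' => by simp [hadd])
    (fun c ψ φ => by simp [hsmul])
  have hpos : ∀ ψ : H, (rankOneTC ψ ψ : H →L[ℂ] H).IsPositive := fun ψ =>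
    InnerProductSpace.isPositive_rankOne_self ψ
  -- Boundedness: `T(|ψ⟩⟨ψ|)` is positive of trace `‖ψ‖²`, so its quadratic form at `a` is at most
  -- `‖a‖² ‖ψ‖²`.
  obtain ⟨Y, -, hY⟩ := exists_op_of_form (LinearIsometry.id (R := ℂ) (E := H))
    denseRange_id q (fun ψ => (T.isPositive (hpos ψ)).inner_nonneg_right a) (‖a‖ ^ 2)
    (fun ψ => by
      refine (inner_le_trace_mul (T.isPositive (hpos ψ)) (T.toLin _).2 a).trans ?_
      rw [T.tracePreserving, trace_rankOneTC, inner_self_eq_norm_sq_to_K, mul_comm]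
      norm_cast)
  exact ⟨Y, hY⟩

/-- A channel is determined on the positive operators by its values on rank one operators. -/
theorem hasSum_inner_toLin (T : Channel H H') {S : H →L[ℂ] H} (hS : IsSelfAdjoint S)
    (hm : S * S ∈ TraceClass H) {ι : Type*} (b : HilbertBasis ι ℂ H) (a : H') :
    HasSum (fun i => (⟪a, (T.toLin (rankOneTC (S (b i)) (S (b i))) : H' →L[ℂ] H') a⟫_ℂ).re)
      (⟪a, (T.toLin ⟨S * S, hm⟩ : H' →L[ℂ] H') a⟫_ℂ).re := by
  have key : ∀ x y : H, ⟪x, S y⟫_ℂ = ⟪S x, y⟫_ℂ := fun x y => (hS.isSymmetric x y).symm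
  let P : TraceClass H := ⟨S * S, hm⟩
  let R : Finset ι → TraceClass H := fun F => ∑ i ∈ F, rankOneTC (S (b i)) (S (b i))
  have hcoe : ∀ F, (R F : H →L[ℂ] H) =
      ∑ i ∈ F, InnerProductSpace.rankOne ℂ (S (b i)) (S (b i)) := fun F => by
    simp [R, coe_rankOneTC]
  -- The remainder is positive by Bessel's inequality for `S x`.
  have hpos : ∀ F, ((P - R F : TraceClass H) : H →L[ℂ] H).IsPositive := fun F => by
    refine isPositive_of_nonneg fun x => ?_
    have h1 := b.orthonormal.sum_inner_products_le (S x) (s := F)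
    have h2 : ⟪x, ((P - R F : TraceClass H) : H →L[ℂ] H) x⟫_ℂ =
        ((‖S x‖ ^ 2 - ∑ i ∈ F, ‖⟪b i, S x⟫_ℂ‖ ^ 2 : ℝ) : ℂ) := by
      rw [AddSubgroupClass.coe_sub, hcoe, sub_apply, inner_sub_right]
      rw [Complex.ofReal_sub, Complex.ofReal_sum]
      congr 1
      · change ⟪x, S (S x)⟫_ℂ = _
        rw [key, inner_self_eq_norm_sq_to_K]; norm_cast
      · rw [_root_.sum_apply, inner_sum]
        refine Finset.sum_congr rfl fun i _ => ?_
        rw [InnerProductSpace.rankOne_apply, inner_smul_right, key, ← key,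
          ← inner_conj_symm (S x), Complex.mul_conj, Complex.normSq_eq_norm_sq]
    rw [h2, Complex.zero_le_real]
    linarith
  -- The trace of the remainder is the tail of the convergent series for `tr (S²)`.
  have ht : Filter.Tendsto (fun F => (trace ((P - R F : TraceClass H) : H →L[ℂ] H)).re)
      Filter.atTop (nhds 0) := by
    have h1 : HasSum (fun i => (⟪b i, (S * S) (b i)⟫_ℂ).re) (trace (S * S)).re :=
      Complex.hasSum_re (hasSum_trace b hm)
    have h2 : ∀ F, (trace ((P - R F : TraceClass H) : H →L[ℂ] H)).re =
        (trace (S * S)).re - ∑ i ∈ F, (⟪b i, (S * S) (b i)⟫_ℂ).re := fun F => by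
      have h3 : trace (S * S) = trace ((P - R F : TraceClass H) : H →L[ℂ] H) +
          trace (R F : H →L[ℂ] H) := by
        rw [← trace_add (P - R F).2 (R F).2]
        congr 1
        rw [AddSubgroupClass.coe_sub, sub_add_cancel]
      have h4 : trace (R F : H →L[ℂ] H) = ∑ i ∈ F, ⟪b i, (S * S) (b i)⟫_ℂ := by
        have : ∀ F, trace (R F : H →L[ℂ] H) = ∑ i ∈ F, ⟪b i, (S * S) (b i)⟫_ℂ := fun F => by
          classical
          induction F using Finset.induction_on with
          | empty => simp [R, trace]
          | insert i F hi ih =>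
            have : R (insert i F) = rankOneTC (S (b i)) (S (b i)) + R F := Finset.sum_insert hi
            rw [this, Submodule.coe_add, trace_add (rankOneTC _ _).2 (R F).2, ih,
              trace_rankOneTC, Finset.sum_insert hi, ← key]
            rfl
        exact this F
      rw [h3, h4, Complex.add_re, Complex.re_sum]
      ring
    simp_rw [h2]
    simpa using (tendsto_const_nhds (x := (trace (S * S)).re)).sub h1
  have hdiff : ∀ F, (⟪a, (T.toLin (P - R F) : H' →L[ℂ] H') a⟫_ℂ).re =
      (⟪a, (T.toLin P : H' →L[ℂ] H') a⟫_ℂ).re -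
        ∑ i ∈ F, (⟪a, (T.toLin (rankOneTC (S (b i)) (S (b i))) : H' →L[ℂ] H') a⟫_ℂ).re :=
    fun F => by
      simp [R]
  -- The image of the remainder is positive with the same trace, so its quadratic form at `a` is
  -- squeezed to zero.
  have hlim : Filter.Tendsto (fun F => (⟪a, (T.toLin (P - R F) : H' →L[ℂ] H') a⟫_ℂ).re)
      Filter.atTop (nhds 0) := by
    refine squeeze_zero (fun F => re_inner_nonneg' (T.isPositive (hpos F)) a)
      (fun F => (inner_le_trace_mul (T.isPositive (hpos F)) (T.toLin _).2 a).trans_eq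
        (by rw [T.tracePreserving])) ?_
    simpa using ht.mul_const (‖a‖ ^ 2)
  have := (tendsto_const_nhds (x := (⟪a, (T.toLin P : H' →L[ℂ] H') a⟫_ℂ).re)).sub hlim
  simp_rw [hdiff] at this
  simpa [HasSum] using this

/-- Three extensions: the bounded operator of `exists_dual_op` passes from matrix units to all
`|φ⟩⟨φ|`; the series of `hasSum_inner_toLin` passes to positive operators; linearity does the rest.
-/
theorem ext_of_rankOne_basis {T T' : Channel H H'} {ι : Type*} (b : HilbertBasis ι ℂ H)
    (h : ∀ m n, T.toLin (rankOneTC (b m) (b n)) = T'.toLin (rankOneTC (b m) (b n))) :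
    T = T' := by
  have h1 : ∀ (a : H') (φ : H), ⟪a, (T.toLin (rankOneTC φ φ) : H' →L[ℂ] H') a⟫_ℂ =
      ⟪a, (T'.toLin (rankOneTC φ φ) : H' →L[ℂ] H') a⟫_ℂ := fun a φ => by
    obtain ⟨Y, hY⟩ := T.exists_dual_op a
    obtain ⟨Y', hY'⟩ := T'.exists_dual_op a
    have : Y = Y' := op_ext_basis b fun m n => by rw [hY, hY', h]
    rw [← hY, ← hY', this]
  refine Channel.ext (LinearMap.ext fun ⟨X, hX⟩ => ?_)
  induction hX using Submodule.span_induction with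
  | mem P hP =>
    obtain ⟨S, hS, rfl⟩ := exists_sqrt hP.1
    have hm := mem_traceClass hP.1 hP.2
    have hp := T.isPositive (S := ⟨S * S, hm⟩) hP.1
    have hp' := T'.isPositive (S := ⟨S * S, hm⟩) hP.1
    -- Over `ℂ` an operator is determined by its quadratic form.
    refine Subtype.ext (ContinuousLinearMap.coe_injective
      ((ext_inner_map _ _).1 fun a => ?_))
    have h2 : ⟪a, (T.toLin ⟨S * S, hm⟩ : H' →L[ℂ] H') a⟫_ℂ =
        ⟪a, (T'.toLin ⟨S * S, hm⟩ : H' →L[ℂ] H') a⟫_ℂ := by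
      rw [inner_eq_ofReal hp, inner_eq_ofReal hp']
      congr 1
      refine (T.hasSum_inner_toLin hS hm b a).unique ?_
      simp_rw [h1]
      exact T'.hasSum_inner_toLin hS hm b a
    have h3 := congrArg (starRingEnd ℂ) h2
    rwa [inner_conj_symm, inner_conj_symm] at h3
  | zero =>
    have : (⟨0, zero_mem _⟩ : TraceClass H) = 0 := rfl
    rw [this, map_zero, map_zero]
  | add A B hA hB ihA ihB =>
    have : (⟨A + B, add_mem hA hB⟩ : TraceClass H) = ⟨A, hA⟩ + ⟨B, hB⟩ := rfl
    rw [this, map_add, map_add, ihA, ihB]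
  | smul c A hA ihA =>
    have : (⟨c • A, Submodule.smul_mem _ c hA⟩ : TraceClass H) = c • ⟨A, hA⟩ := rfl
    rw [this, map_smul, map_smul, ihA]

end Channel

/-! ### Hilbert–Schmidt operators as vectors and Stinespring channels -/

section Dilation

variable {H H' E : Type*}
  [NormedAddCommGroup H] [InnerProductSpace ℂ H] [CompleteSpace H]
  [NormedAddCommGroup H'] [InnerProductSpace ℂ H'] [CompleteSpace H']
  [NormedAddCommGroup E] [InnerProductSpace ℂ E] [CompleteSpace E]

/-- A Hilbert–Schmidt operator `W` yields the vector `∑ₖ fₖ ⊗ W fₖ`. -/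
theorem exists_vector_of_hilbertSchmidt {κ μ : Type*} (f : HilbertBasis κ ℂ E)
    (g : HilbertBasis μ ℂ H') (W : E →L[ℂ] H') (h : posTrace (W ∘L W.adjoint) ≠ ⊤) :
    ∃ v : HTensor E H', ∀ k j, ⟪tens (f k) (g j), v⟫_ℂ = ⟪g j, W (f k)⟫_ℂ := by
  have hp : (W.adjoint ∘L W).IsPositive := ContinuousLinearMap.isPositive_adjoint_comp_self W
  have e : ∀ x : E, (⟪x, (W.adjoint ∘L W) x⟫_ℂ).re = ‖W x‖ ^ 2 := fun x => by
    rw [ContinuousLinearMap.comp_apply, ContinuousLinearMap.adjoint_inner_right,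
      inner_self_eq_norm_sq_to_K]; norm_cast
  rw [posTrace_adjoint_comp, posTrace_eq f hp] at h
  simp_rw [e, ofReal_norm_sq_eq_tsum g] at h
  rw [← ENNReal.tsum_prod (f := fun k j => ENNReal.ofReal (‖⟪g j, W (f k)⟫_ℂ‖ ^ 2))] at h
  have hs := ENNReal.summable_toReal h
  -- The matrix elements of `W` are square summable, with sum `tr (W†W) = tr (W W†)`, and serve as
  -- coordinates of the vector.
  have hl : Memℓp (fun p : κ × μ => ⟪g p.2, W (f p.1)⟫_ℂ) 2 := memℓp_gen (by
    simpa [ENNReal.toReal_ofReal (sq_nonneg _)] using hs)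
  refine ⟨(prodBasis f g).repr.symm ⟨_, hl⟩, fun k j => ?_⟩
  rw [← prodBasis_apply f g (k, j), ← HilbertBasis.repr_apply_apply,
    LinearIsometryEquiv.apply_symm_apply]

theorem hasSum_inner_mul_inner_adjoint {κ : Type*} (f : HilbertBasis κ ℂ E)
    (W W' : E →L[ℂ] H') (a c : H') :
    HasSum (fun k => ⟪a, W (f k)⟫_ℂ * ⟪W' (f k), c⟫_ℂ) ⟪a, (W ∘L W'.adjoint) c⟫_ℂ := by
  have := f.hasSum_inner_mul_inner (W.adjoint a) (W'.adjoint c)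
  simp_rw [ContinuousLinearMap.adjoint_inner_left, ContinuousLinearMap.adjoint_inner_right] at this
  exact this

/-- Vectorization carries the Hilbert–Schmidt inner product to that of `E ⊗ H'`: both are the sum of
products of matrix elements. This turns trace relations into orthonormality. -/
theorem inner_eq_trace_of_hilbertSchmidt {κ μ : Type*} (f : HilbertBasis κ ℂ E)
    (g : HilbertBasis μ ℂ H') {W W' : E →L[ℂ] H'} (hm : W' ∘L W.adjoint ∈ TraceClass H')
    {v v' : HTensor E H'}
    (hv : ∀ k j, ⟪tens (f k) (g j), v⟫_ℂ = ⟪g j, W (f k)⟫_ℂ)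
    (hv' : ∀ k j, ⟪tens (f k) (g j), v'⟫_ℂ = ⟪g j, W' (f k)⟫_ℂ) :
    ⟪v, v'⟫_ℂ = trace (W' ∘L W.adjoint) := by
  have h1 := (prodBasis f g).hasSum_inner_mul_inner v v'
  have h2 := (Equiv.prodComm _ _).hasSum_iff.2 h1
  have h3 := h2.prod_fiberwise (g := fun j => ⟪g j, (W' ∘L W.adjoint) (g j)⟫_ℂ) fun j => by
    have h4 := hasSum_inner_mul_inner_adjoint f W' W (g j) (g j)
    refine Eq.subst (motive := fun F : κ → ℂ => HasSum F _) (funext fun k => ?_) h4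
    change _ = ⟪v, prodBasis f g (k, j)⟫_ℂ * ⟪prodBasis f g (k, j), v'⟫_ℂ
    rw [prodBasis_apply, ← inner_conj_symm v, hv, hv', inner_conj_symm, mul_comm]
  exact h3.unique (hasSum_trace g hm)

namespace Channel

/-- The Kraus form `∑ₖ Kₖ S Kₖ†` with `Kₖ = (⟨f k| ⊗ 1) V`, in matrix elements: `V†(f k ⊗ a)` is
`Kₖ† a`. Linearity and complete positivity of `ofIsometry` are read off term by term. -/
theorem hasSum_inner_ptraceFst_conj {κ : Type*} (f : HilbertBasis κ ℂ E)
    (V : H →L[ℂ] HTensor E H') (S : H →L[ℂ] H)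
    (hm : V ∘L S ∘L V.adjoint ∈ TraceClass (HTensor E H')) (a c : H') :
    HasSum (fun k => ⟪V.adjoint (tens (f k) a), S (V.adjoint (tens (f k) c))⟫_ℂ)
      ⟪a, (ptraceFst ⟨_, hm⟩ : H' →L[ℂ] H') c⟫_ℂ := by
  rw [inner_ptraceFst]
  have := hasSum_trace f (slice_mem hm a c)
  simpa [inner_slice, ContinuousLinearMap.adjoint_inner_left] using this

/-- The channel `S ↦ tr₁ (V S V†)` of an isometry `V : H → E ⊗ H'`. -/
def ofIsometry (V : H →L[ℂ] HTensor E H') (hV : V.adjoint ∘L V = 1) : Channel H H' where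
  toLin :=
    { toFun := fun S => ptraceFst ⟨_, (isometry_conj V hV S.2).1⟩
      map_add' := fun S S' => Subtype.ext (op_ext fun a c => by
        have h1 := hasSum_inner_ptraceFst_conj (stdBasis E) V S (isometry_conj V hV S.2).1 a c
        have h2 := hasSum_inner_ptraceFst_conj (stdBasis E) V S' (isometry_conj V hV S'.2).1 a c
        have h3 := hasSum_inner_ptraceFst_conj (stdBasis E) V (S + S' : TraceClass H)
          (isometry_conj V hV (S + S').2).1 a c
        refine h3.unique ?_
        simpa [inner_add_right] using h1.add h2)
      map_smul' := fun r S => Subtype.ext (op_ext fun a c => by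
        have h1 := hasSum_inner_ptraceFst_conj (stdBasis E) V S (isometry_conj V hV S.2).1 a c
        have h3 := hasSum_inner_ptraceFst_conj (stdBasis E) V (r • S : TraceClass H)
          (isometry_conj V hV (r • S).2).1 a c
        refine h3.unique ?_
        simpa [inner_smul_right] using h1.mul_left r) }
  completelyPositive := fun n S hS x => by
    have h := hasSum_sum (s := Finset.univ) fun i _ => hasSum_sum (s := Finset.univ)
      fun j _ => hasSum_inner_ptraceFst_conj (stdBasis E) V (S i j)
        (isometry_conj V hV (S i j).2).1 (x i) (x j)
    -- For each `k` the term is the form of the matrix `S` on the vectors `Kₖ† xᵢ`.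
    exact h.nonneg fun k => hS fun i => V.adjoint (tens (stdBasis E k) (x i))
  tracePreserving := fun S => (trace_ptraceFst _).trans (isometry_conj V hV S.2).2

/-- A family of operators `Wₘ` with `tr (Wₘ Wₙ†) = δₘₙ` defines a channel that maps
`|bₘ⟩⟨bₙ|` to `Wₘ Wₙ†`. -/
theorem exists_of_orthonormal_hilbertSchmidt {ι : Type*} [DecidableEq ι]
    (b : HilbertBasis ι ℂ H) (W : ι → E →L[ℂ] H')
    (hm : ∀ m n, W m ∘L (W n).adjoint ∈ TraceClass H')
    (ht : ∀ m n, trace (W m ∘L (W n).adjoint) = if m = n then 1 else 0) :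
    ∃ T : Channel H H', ∀ m n,
      (T.toLin (rankOneTC (b m) (b n)) : H' →L[ℂ] H') = W m ∘L (W n).adjoint := by
  set f := stdBasis E
  set g := stdBasis H'
  have hfin : ∀ m, posTrace (W m ∘L (W m).adjoint) ≠ ⊤ := fun m => by
    rw [posTrace_eq_trace (ContinuousLinearMap.isPositive_self_comp_adjoint _) (hm m m)]
    exact ENNReal.ofReal_ne_top
  choose v hv using fun m => exists_vector_of_hilbertSchmidt f g (W m) (hfin m)
  have ho : Orthonormal ℂ v := by
    rw [orthonormal_iff_ite]
    intro m n
    rw [inner_eq_trace_of_hilbertSchmidt f g (hm n m) (hv m) (hv n), ht]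
    simp only [eq_comm]
  -- Orthonormality of `v` lets `b n ↦ v n` extend to an isometry.
  let V₀ : H →ₗᵢ[ℂ] HTensor E H' :=
    ho.orthogonalFamily.linearIsometry.comp b.repr.toLinearIsometry
  have hVb : ∀ n, V₀ (b n) = v n := fun n => by
    simp [V₀, HilbertBasis.repr_self, OrthogonalFamily.linearIsometry_apply_single]
  let V : H →L[ℂ] HTensor E H' := V₀.toContinuousLinearMap
  have hV : V.adjoint ∘L V = 1 := op_ext fun x y => by
    rw [ContinuousLinearMap.comp_apply, ContinuousLinearMap.adjoint_inner_right]
    exact V₀.inner_map_map x y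
  refine ⟨ofIsometry V hV, fun m n => op_ext_basis g fun i j => ?_⟩
  have h1 := hasSum_inner_ptraceFst_conj f V (rankOneTC (b m) (b n) : TraceClass H)
    (isometry_conj V hV (rankOneTC (b m) (b n)).2).1 (g i) (g j)
  have h2 := hasSum_inner_mul_inner_adjoint f (W m) (W n) (g i) (g j)
  refine h1.unique ?_
  -- The two series agree termwise: the `k`-th Kraus term is `⟨f k ⊗ g i, v m⟩⟨v n, f k ⊗ g j⟩`, and
  -- these coordinates are the matrix elements of `W m` and `W n`.
  convert h2 using 2 with k
  rw [coe_rankOneTC, InnerProductSpace.rankOne_apply, inner_smul_right,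
    ContinuousLinearMap.adjoint_inner_left, ContinuousLinearMap.adjoint_inner_right, mul_comm]
  change ⟪tens (f k) (g i), V₀ (b m)⟫_ℂ * ⟪V₀ (b n), tens (f k) (g j)⟫_ℂ = _
  rw [hVb, hVb, hv, ← inner_conj_symm (v n), hv, inner_conj_symm]

end Channel

end Dilation

end QChannel

end

/-- For a full rank state `σ` of Bob with eigenbasis `b` and eigenvalues `s`, the map
`T ↦ (T ⊗ Id)(|Ω_σ⟩⟨Ω_σ|)` is a bijection from the quantum channels from Bob to Alice onto the
bipartite states with marginal `σ` on Bob's side. -/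
theorem lemma1 {HA HB : Type*}
    [NormedAddCommGroup HA] [InnerProductSpace ℂ HA] [CompleteSpace HA]
    [NormedAddCommGroup HB] [InnerProductSpace ℂ HB] [CompleteSpace HB]
    (σ : QChannel.TraceClass HB) (hσ : QChannel.IsState σ)
    (hfull : DenseRange (σ : HB →L[ℂ] HB))
    {ι : Type*} (b : HilbertBasis ι ℂ HB) (s : ι → ℝ)
    (hs : ∀ n, (σ : HB →L[ℂ] HB) (b n) = (s n : ℂ) • b n) :
    Set.BijOn
      (fun T : QChannel.Channel HB HA =>
        T.tensorId (QChannel.ketBra (QChannel.purification b s)))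
      Set.univ
      {ρ : QChannel.TraceClass (QChannel.HTensor HA HB) |
        QChannel.IsState ρ ∧ QChannel.ptraceFst ρ = σ} := by
  classical
  have hpos := QChannel.eigenvalue_pos hσ hfull b hs
  have hsqrt : ∀ n, (√(s n) : ℂ) ≠ 0 := fun n =>
    Complex.ofReal_ne_zero.2 (Real.sqrt_pos.2 (hpos n)).ne'
  have hne : ∀ m n, (√(s m) : ℂ) * (√(s n) : ℂ) ≠ 0 := fun m n =>
    mul_ne_zero (hsqrt m) (hsqrt n)
  have hslice := QChannel.sliceTC_purification hσ b hs
  have hptr := QChannel.ptraceFst_purification hσ b hs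
  refine ⟨fun T _ => ⟨⟨?_, ?_⟩, ?_⟩, fun T _ T' _ h => ?_, fun ρ hρ => ?_⟩
  · exact T.tensorId_isPositive (InnerProductSpace.isPositive_rankOne_self _)
  · rw [T.trace_tensorId, ← QChannel.trace_ptraceFst, hptr, hσ.2]
  · exact (T.ptraceFst_tensorId _).trans hptr
  · refine QChannel.Channel.ext_of_rankOne_basis b fun m n => ?_
    have h1 := congrArg (QChannel.sliceTC (b m) (b n)) h
    simp only [QChannel.Channel.sliceTC_tensorId, hslice, map_smul] at h1
    -- Equal slices agree up to the common factor `√(s m) √(s n)`, cancelled because full rank makes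
    -- it nonzero.
    exact smul_right_injective _ (hne m n) h1
  · obtain ⟨⟨hρ0, -⟩, hρσ⟩ := hρ
    obtain ⟨R, hR, hRR⟩ := QChannel.exists_sqrt hρ0
    have key : ∀ x y, ⟪x, R y⟫_ℂ = ⟪R x, y⟫_ℂ := fun x y => (hR.isSymmetric x y).symm
    -- The environment is `HA ⊗ HB` itself; the factor `R` on the right makes `Wₘ Wₙ†` produce `R R
    -- = ρ` between the two slice maps.
    let W : ι → QChannel.HTensor HA HB →L[ℂ] HA := fun n =>
      (√(s n) : ℂ)⁻¹ • ((QChannel.inclFst (b n)).adjoint ∘L R)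
    have hWadj : ∀ n, (W n).adjoint = (√(s n) : ℂ)⁻¹ • (R ∘L QChannel.inclFst (b n)) := fun n => by
      rw [map_smulₛₗ, ContinuousLinearMap.adjoint_comp, ContinuousLinearMap.adjoint_adjoint,
        hR.adjoint_eq, map_inv₀, Complex.conj_ofReal]
    have hW : ∀ m n, W m ∘L (W n).adjoint = ((√(s m) : ℂ) * (√(s n) : ℂ))⁻¹ •
        QChannel.slice (b m) (b n)
          (ρ : QChannel.HTensor HA HB →L[ℂ] QChannel.HTensor HA HB) := fun m n => by
      rw [hWadj, hRR, ContinuousLinearMap.smul_comp, ContinuousLinearMap.comp_smul, smul_smul,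
        mul_inv]
      rfl
    have hm : ∀ m n, W m ∘L (W n).adjoint ∈ QChannel.TraceClass HA := fun m n => by
      rw [hW]
      exact Submodule.smul_mem _ _ (QChannel.slice_mem ρ.2 _ _)
    -- The marginal enters here: the slice of `ρ` has trace `⟨b m, σ (b n)⟩ = s n δₘₙ`, which the
    -- prefactor normalizes to `δₘₙ`.
    have ht : ∀ m n, QChannel.trace (W m ∘L (W n).adjoint) = if m = n then 1 else 0 :=
      fun m n => by
        rw [hW, QChannel.trace_smul, ← QChannel.inner_ptraceFst, hρσ, hs, inner_smul_right,
          orthonormal_iff_ite.1 b.orthonormal]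
        by_cases h : m = n
        · subst h
          rw [← Complex.ofReal_mul, Real.mul_self_sqrt (hpos m).le]
          simp [(hpos m).ne']
        · simp [h]
    obtain ⟨T, hT⟩ := QChannel.Channel.exists_of_orthonormal_hilbertSchmidt b W hm ht
    refine ⟨T, trivial, Subtype.ext (QChannel.op_ext_slice_basis b fun m n => ?_)⟩
    have h1 := congrArg Subtype.val
      (T.sliceTC_tensorId (QChannel.ketBra (QChannel.purification b s)) (b m) (b n))
    refine h1.trans ?_
    rw [hslice, map_smul]
    change _ • (T.toLin (QChannel.rankOneTC (b m) (b n)) : HA →L[ℂ] HA) = _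
    rw [hT, hW, smul_smul, mul_inv_cancel₀ (hne m n), one_smul]
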